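/- Let $\Pi^+=\{z\in\mathbb C:\operatorname{Im} z>0\}$, let $$\Sigma=\{(y_1,y_2,y_3)\in\mathbb R^3:\ y_1y_2-y_3^2>0,\ y_1>0\},\qquad T_\Sigma=\mathbb R^3+i\Sigma\subset\mathbb C^3,$$ and put $\Delta(t)=t_1t_2-t_3^2$ and $\langle z,t\rangle=\tfrac12(z_1t_1+z_2t_2)+z_3t_3$. The Hardy space $H^2(T_\Sigma)$ consists of the holomorphic functions $F$ on $T_\Sigma$ with $$\|F\|_{H^2(T_\Sigma)}=\Big(\sup_{y\in\Sigma}\int_{\mathbb R^3}|F(x+iy)|^2\,dx\Big)^{1/2}<\infty .$$ The box operator $\Box=\Delta\big(\tfrac1i\tfrac{\partial}{\partial x}\big)$ is the constant-coefficient differential operator with $\Box\,e^{i\langle z,\xi\rangle}=\Delta(\xi)e^{i\langle z,\xi\rangle}$, that is, $\Box=-4\,\frac{\partial^2}{\partial x_1\partial x_2}+\frac{\partial^2}{\partial x_3^2}$. For an integer $m\ge 0$, a positive Borel measure $\nu$ on $T_\Sigma$ is called an $m$-box Carleson measure for $H^2(T_\Sigma)$ if there is a constant $C>0$ such that $$\int_{T_\Sigma}|\Box^mF|^2\,d\nu\le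 C\,\|F\|_{H^2(T_\Sigma)}^2\qquad\text{for every }F\in H^2(T_\Sigma).$$ For $\alpha>-1$ the weighted Bergman space $A^2_\alpha(\Pi^+\times\Pi^+)$ consists of the holomorphic functions $G$ on $\Pi^+\times\Pi^+$ with $$\|G\|_{A^2_\alpha}=\Big(\int_{\Pi^+\times\Pi^+}|G(x_1+iy_1,x_2+iy_2)|^2\,y_1^{\alpha}y_2^{\alpha}\,dx_1dx_2dy_1dy_2\Big)^{1/2}<\infty ,$$ and a positive Borel measure $\mu$ on $\Pi^+\times\Pi^+$ is called a Carleson measure for $A^2_\alpha(\Pi^+\times\Pi^+)$ if there is a constant $C>0$ such that $\int_{\Pi^+\times\Pi^+}|G|^2\,d\mu\le C\|G\|_{A^2_\alpha}^2$ for every $G\in A^2_\alpha(\Pi^+\times\Pi^+)$. **Theorem.** Let $\mu$ be a positive Borel measure on $\Pi^+\times\Pi^+$, let $m\ge 0$ be an integer, and let $\delta_0$ be the Dirac measure at the origin of $\mathbb C$. Then the following are equivalent. 1. $\mu(z_1,z_2)\,\delta_0(z_3)$ is an $m$-box Carleson measure for $H^2(T_\Sigma)$. 2. $\mu$ is a Carleson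 measure for the weighted Bergman space $A^2_{2m-\frac12}(\Pi^+\times\Pi^+)$. -/

import Mathlib

open Complex MeasureTheory
open scoped ENNReal

noncomputable section

/-- `ℝ³`, with coordinates `t₁ = t.1.1`, `t₂ = t.1.2`, `t₃ = t.2`. -/
abbrev R3 : Type := (ℝ × ℝ) × ℝ

/-- `ℂ³`, with coordinates `z₁ = z.1.1`, `z₂ = z.1.2`, `z₃ = z.2`. -/
abbrev C3 : Type := (ℂ × ℂ) × ℂ

/-- The point `x + i y` of `ℂ³`. -/
def tubePoint (x y : R3) : C3 :=
  (((x.1.1 : ℂ) + y.1.1 * I, (x.1.2 : ℂ) + y.1.2 * I), (x.2 : ℂ) + y.2 * I)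

/-- The imaginary part `y` of `z = x + i y`. -/
def imPart (z : C3) : R3 := ((z.1.1.im, z.1.2.im), z.2.im)

/-- The determinant function `Δ(t) = t₁ t₂ - t₃²`. -/
def coneDet (t : R3) : ℝ := t.1.1 * t.1.2 - t.2 ^ 2

/-- The spherical cone `Σ = {y : y₁ y₂ - y₃² > 0, y₁ > 0}` in `ℝ³`. -/
def sphericalCone : Set R3 := {y | 0 < coneDet y ∧ 0 < y.1.1}

/-- The tube domain `T_Σ = ℝ³ + i Σ`. -/
def tubeDomain : Set C3 := {z | imPart z ∈ sphericalCone}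

/-- The product `Π⁺ × Π⁺` of two upper half-planes. -/
def biHalfPlane : Set (ℂ × ℂ) := {z | 0 < z.1.im ∧ 0 < z.2.im}

/-- The pairing `⟨z, ξ⟩ = (z₁ ξ₁ + z₂ ξ₂) / 2 + z₃ ξ₃` (complex bilinear extension of the scalar
product for which `Σ` is self-dual). -/
def conePairing (z : C3) (ξ : R3) : ℂ :=
  (1 / 2 : ℂ) * (z.1.1 * ξ.1.1 + z.1.2 * ξ.1.2) + z.2 * ξ.2

/-- The first of the three operators `(1/i) ∂_j`, where `(∂₁, ∂₂, ∂₃) = (2 ∂/∂x₁, 2 ∂/∂x₂, ∂/∂x₃)` is the gradient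
in the real variable `x` for the scalar product `⟨x, ξ⟩ = (x₁ ξ₁ + x₂ ξ₂) / 2 + x₃ ξ₃`. -/
def opD1 (F : C3 → ℂ) : C3 → ℂ := fun z => (2 / I) * lineDeriv ℝ F z ((1, 0), 0)

/-- The operator `(1/i) ∂₂`, with `∂₂ = 2 ∂/∂x₂`. -/
def opD2 (F : C3 → ℂ) : C3 → ℂ := fun z => (2 / I) * lineDeriv ℝ F z ((0, 1), 0)

/-- The operator `(1/i) ∂₃`, with `∂₃ = ∂/∂x₃`. -/
def opD3 (F : C3 → ℂ) : C3 → ℂ := fun z => (1 / I) * lineDeriv ℝ F z ((0, 0), 1)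

/-- The box operator `□ = Δ((1/i) ∂/∂x)`. It is determined by
`□ e^{i⟨z, ξ⟩} = Δ(ξ) e^{i⟨z, ξ⟩}`, see `box_exp`. -/
def box (F : C3 → ℂ) : C3 → ℂ := fun z => opD1 (opD2 F) z - opD3 (opD3 F) z

/-- The norm `‖F‖_{H²(T_Σ)}`, as an extended nonnegative number. -/
def hardyNorm (F : C3 → ℂ) : ℝ≥0∞ :=
  (⨆ y ∈ sphericalCone, ∫⁻ x : R3, ‖F (tubePoint x y)‖ₑ ^ 2) ^ (1 / 2 : ℝ)

/-- `F` (through its values on `T_Σ`) belongs to the Hardy space `H²(T_Σ)`. -/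
def MemHardy (F : C3 → ℂ) : Prop :=
  DifferentiableOn ℂ F tubeDomain ∧ hardyNorm F < ∞

/-- The measure `ν` on `T_Σ` is a `k`-box Carleson measure for `H²(T_Σ)`. -/
def IsBoxCarleson (k : ℕ) (ν : Measure C3) : Prop :=
  ∃ C : ℝ, 0 < C ∧ ∀ F : C3 → ℂ, MemHardy F →
    ∫⁻ z in tubeDomain, ‖(box^[k] F) z‖ₑ ^ 2 ∂ν ≤ ENNReal.ofReal C * hardyNorm F ^ 2

/-- The norm of the weighted Bergman space `A²_α(Π⁺ × Π⁺)`, as an extended nonnegative number. -/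
def bergmanNorm (α : ℝ) (G : ℂ × ℂ → ℂ) : ℝ≥0∞ :=
  (∫⁻ z in biHalfPlane, ‖G z‖ₑ ^ 2 * ENNReal.ofReal (z.1.im ^ α * z.2.im ^ α)) ^ (1 / 2 : ℝ)

/-- `G` (through its values on `Π⁺ × Π⁺`) belongs to `A²_α(Π⁺ × Π⁺)`. -/
def MemBergman (α : ℝ) (G : ℂ × ℂ → ℂ) : Prop :=
  DifferentiableOn ℂ G biHalfPlane ∧ bergmanNorm α G < ∞

/-- The measure `μ` on `Π⁺ × Π⁺` is a Carleson measure for `A²_α(Π⁺ × Π⁺)`. -/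
def IsBergmanCarleson (α : ℝ) (μ : Measure (ℂ × ℂ)) : Prop :=
  ∃ C : ℝ, 0 < C ∧ ∀ G : ℂ × ℂ → ℂ, MemBergman α G →
    ∫⁻ z in biHalfPlane, ‖G z‖ₑ ^ 2 ∂μ ≤ ENNReal.ofReal C * bergmanNorm α G ^ 2

lemma lineDeriv_exp_pairing (c : ℂ) (ξ : R3) (v z : C3) :
    lineDeriv ℝ (fun z => c * exp (I * conePairing z ξ)) z v
      = c * (I * conePairing v ξ) * exp (I * conePairing z ξ) := by
  have h : ∀ t : ℝ, conePairing (z + t • v) ξ = conePairing z ξ + t * conePairing v ξ := by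
    intro t
    simp only [conePairing, Prod.fst_add, Prod.snd_add, Prod.smul_fst, Prod.smul_snd, real_smul]
    ring
  have h1 : HasDerivAt (fun t : ℝ => I * (conePairing z ξ + (t : ℂ) * conePairing v ξ))
      (I * (1 * conePairing v ξ)) (0 : ℝ) :=
    (((hasDerivAt_id (0 : ℝ)).ofReal_comp.mul_const _).const_add _).const_mul _
  have h2 := (h1.cexp.const_mul c).deriv
  simp only [lineDeriv, h]
  rw [h2]
  simp
  ring

/-- The defining property of the box operator. -/
theorem box_exp (ξ : R3) (z : C3) :
    box (fun z => exp (I * conePairing z ξ)) z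
      = (coneDet ξ : ℂ) * exp (I * conePairing z ξ) := by
  have h := lineDeriv_exp_pairing 1 ξ
  simp only [one_mul] at h
  have h2 : opD2 (fun z => exp (I * conePairing z ξ))
      = fun z => (2 / I * (I * conePairing ((0, 1), 0) ξ)) * exp (I * conePairing z ξ) := by
    funext w
    simp only [opD2, h, mul_assoc]
  have h3 : opD3 (fun z => exp (I * conePairing z ξ))
      = fun z => (1 / I * (I * conePairing ((0, 0), 1) ξ)) * exp (I * conePairing z ξ) := by
    funext w
    simp only [opD3, h, mul_assoc]
  simp only [box, h2, h3, opD1, opD3, lineDeriv_exp_pairing]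
  simp only [conePairing, coneDet]
  push_cast
  field_simp
  ring

end

/-! By Paley–Wiener, a function `F` in the Hardy space is the Fourier–Laplace integral of a square
integrable density `f` carried by the dual cone `ξ₃² ≤ 4 ξ₁ ξ₂`, and `□` multiplies that density by
`4π² (4 ξ₁ ξ₂ - ξ₃²)`. Setting `z₃ = 0` removes `ξ₃` from the phase, so `□^m F` restricted to `Π⁺ ×
Π⁺` is the Fourier–Laplace integral of `g(ξ) = ∫ symbol(ξ, s)^m f(ξ, s) ds`, where `|s| ≤ 2√p` and
`p = ξ₁ ξ₂`. On the other side, the norm of `A²_α` is a weighted `L²` norm of the density, with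
weight a constant times `p^(-(α+1))`.

Cauchy–Schwarz on the slice gives `|g(ξ)|² ≲ p^(2m) √p ∫ |f(ξ, s)|² ds`, which the weight balances
exactly when `α + 1 = 2m + 1/2` (`MemHardy.exists_memBergman`). Conversely, `g` lifts to `f = g /
(2√p · symbol^m)` on the smaller slice `|s| ≤ √p`, where the symbol is comparable to `p`
(`MemBergman.exists_memHardy`). Thus `F ↦ □^m F (·, 0)` is bounded from `H²` onto `A²_{2m-1/2}` with
a bounded right inverse. Since the measure only sees these restrictions, the two Carleson
inequalities are equivalent.

Both Paley–Wiener theorems come from one statement on tubes,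
`IsSquareIntegrableOnTube.exists_fourier_repr`: after Gaussian damping, Cauchy's theorem lets one
move between real fibres, so the Fourier transforms of the fibres differ only by the factors
`e^{-2π⟨y, ξ⟩}`. -/

noncomputable section

/-! ### Plancherel for integrable functions: the `L²` transform and the integral agree. -/

section PlancherelIntegrable

open FourierTransform SchwartzMap

variable {V : Type*} [NormedAddCommGroup V] [InnerProductSpace ℝ V] [FiniteDimensional ℝ V]
  [MeasurableSpace V] [BorelSpace V]

/-- The `L²` Fourier transform of an integrable function is given by the Fourier integral. -/
theorem coeFn_fourier_toLp_ae_eq {f : V → ℂ} (hf : Integrable f) (hf2 : MemLp f 2) :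
    (𝓕 (hf2.toLp f) : Lp ℂ 2 (volume : Measure V)) =ᵐ[volume] 𝓕 f := by
  have hcont : Continuous (𝓕 f) := VectorFourier.fourierIntegral_continuous
    Real.continuous_fourierChar (by exact continuous_inner) hf
  refine ae_eq_of_integral_contDiff_smul_eq
    ((Lp.memLp (𝓕 (hf2.toLp f) : Lp ℂ 2 (volume : Measure V))).locallyIntegrable (by norm_num))
    hcont.locallyIntegrable fun g hg hgs => ?_
  have hg' : HasCompactSupport (fun x => (g x : ℂ)) := hgs.comp_left (g := fun x : ℝ => (x : ℂ)) rfl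
  have hgd : ContDiff ℝ (⊤ : ℕ∞) (fun x => (g x : ℂ)) := ofRealCLM.contDiff.comp hg
  set φ : 𝓢(V, ℂ) := hg'.toSchwartzMap hgd with hφ
  have hφx : ∀ x, φ x = (g x : ℂ) := fun x => rfl
  have h1 := congrArg (fun T => T φ) (Lp.fourier_toTemperedDistribution_eq (hf2.toLp f))
  simp only [TemperedDistribution.fourier_apply, Lp.toTemperedDistribution_apply] at h1
  have h2 : ∫ x, (𝓕 φ) x • (hf2.toLp f) x = ∫ x, (𝓕 φ) x • f x :=
    integral_congr_ae (by filter_upwards [hf2.coeFn_toLp] with x hx; rw [hx])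
  have h3 : ∫ ξ, (𝓕 (φ : V → ℂ) ξ) • f ξ = ∫ x, φ x • 𝓕 f x :=
    VectorFourier.integral_fourierIntegral_smul_eq_flip (L := innerₗ V)
      Real.continuous_fourierChar (by exact continuous_inner) φ.integrable hf |>.trans (by
        rw [flip_innerₗ]; rfl)
  rw [h2, SchwartzMap.fourier_coe, h3] at h1
  simpa [hφx] using h1.symm

/-- The inverse `L²` Fourier transform of an integrable function is given by the integral. -/
theorem coeFn_fourierInv_toLp_ae_eq {f : V → ℂ} (hf : Integrable f) (hf2 : MemLp f 2) :
    (𝓕⁻ (hf2.toLp f) : Lp ℂ 2 (volume : Measure V)) =ᵐ[volume] 𝓕⁻ f := by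
  have hcont : Continuous (𝓕⁻ f) := VectorFourier.fourierIntegral_continuous
    (L := -innerₗ V) Real.continuous_fourierChar (by exact continuous_inner.neg) hf
  refine ae_eq_of_integral_contDiff_smul_eq
    ((Lp.memLp (𝓕⁻ (hf2.toLp f) : Lp ℂ 2 (volume : Measure V))).locallyIntegrable (by norm_num))
    hcont.locallyIntegrable fun g hg hgs => ?_
  have hg' : HasCompactSupport (fun x => (g x : ℂ)) := hgs.comp_left (g := fun x : ℝ => (x : ℂ)) rfl
  have hgd : ContDiff ℝ (⊤ : ℕ∞) (fun x => (g x : ℂ)) := ofRealCLM.contDiff.comp hg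
  set φ : 𝓢(V, ℂ) := hg'.toSchwartzMap hgd with hφ
  have hφx : ∀ x, φ x = (g x : ℂ) := fun x => rfl
  have h1 := congrArg (fun T => T φ) (Lp.fourierInv_toTemperedDistribution_eq (hf2.toLp f))
  simp only [TemperedDistribution.fourierInv_apply, Lp.toTemperedDistribution_apply] at h1
  have h2 : ∫ x, (𝓕⁻ φ) x • (hf2.toLp f) x = ∫ x, (𝓕⁻ φ) x • f x :=
    integral_congr_ae (by filter_upwards [hf2.coeFn_toLp] with x hx; rw [hx])
  have h3 : ∫ ξ, (𝓕⁻ (φ : V → ℂ) ξ) • f ξ = ∫ x, φ x • 𝓕⁻ f x :=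
    VectorFourier.integral_fourierIntegral_smul_eq_flip (L := -innerₗ V)
      Real.continuous_fourierChar (by exact continuous_inner.neg) φ.integrable hf |>.trans (by
        have : (-innerₗ V).flip = -innerₗ V := by
          ext x y; simp [real_inner_comm]
        rw [this]; rfl)
  rw [h2, SchwartzMap.fourierInv_coe, h3] at h1
  simpa [hφx] using h1.symm

theorem lintegral_enorm_sq_eq_eLpNorm_sq {α : Type*} [MeasurableSpace α] {μ : Measure α}
    (f : α → ℂ) : ∫⁻ x, ‖f x‖ₑ ^ 2 ∂μ = eLpNorm f 2 μ ^ 2 := by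
  have := eLpNorm_nnreal_pow_eq_lintegral (f := f) (μ := μ) (p := 2) (by norm_num)
  norm_num at this
  exact_mod_cast this.symm

theorem memLp_two_iff_lintegral {α : Type*} [MeasurableSpace α] {μ : Measure α}
    {f : α → ℂ} (hf : AEStronglyMeasurable f μ) : MemLp f 2 μ ↔ ∫⁻ x, ‖f x‖ₑ ^ 2 ∂μ < ∞ := by
  rw [lintegral_enorm_sq_eq_eLpNorm_sq, MemLp]
  simp [hf, ENNReal.pow_lt_top_iff]

/-- Plancherel's theorem for functions that are integrable and square integrable. -/
theorem lintegral_fourierInv_sq {f : V → ℂ} (hf : Integrable f) (hf2 : MemLp f 2) :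
    ∫⁻ x, ‖𝓕⁻ f x‖ₑ ^ 2 = ∫⁻ x, ‖f x‖ₑ ^ 2 := by
  rw [lintegral_enorm_sq_eq_eLpNorm_sq, lintegral_enorm_sq_eq_eLpNorm_sq,
    ← eLpNorm_congr_ae (coeFn_fourierInv_toLp_ae_eq hf hf2), ← eLpNorm_congr_ae hf2.coeFn_toLp,
    ← Lp.enorm_def, ← Lp.enorm_def]
  congr 1
  rw [← ofReal_norm, ← ofReal_norm]
  congr 1
  exact (Lp.fourierTransformₗᵢ V ℂ).symm.norm_map _

/-- If the right side is infinite there is nothing to prove, so square integrability need not be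
checked when this is applied. -/
theorem lintegral_fourierInv_sq_le {f : V → ℂ} (hf : Integrable f) :
    ∫⁻ x, ‖𝓕⁻ f x‖ₑ ^ 2 ≤ ∫⁻ x, ‖f x‖ₑ ^ 2 := by
  by_cases h : ∫⁻ x, ‖f x‖ₑ ^ 2 < ∞
  · exact (lintegral_fourierInv_sq hf ((memLp_two_iff_lintegral hf.1).2 h)).le
  · rw [not_lt_top_iff.1 h]
    exact le_top

end PlancherelIntegrable

/-! ### Cauchy's theorem between real fibres of a tube, with Gaussian damping. -/

section TubeShift

open Set

variable {V : Type*} [NormedAddCommGroup V] [InnerProductSpace ℝ V] [FiniteDimensional ℝ V]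
  [MeasurableSpace V] [BorelSpace V]

theorem integrable_prod_comp_add_smul {g : V → ℂ} (hg : Integrable g) (hgc : Continuous g) (v : V) :
    Integrable (fun p : V × ℝ => g (p.1 + p.2 • v))
      ((volume : Measure V).prod (volume.restrict (Ioc (0 : ℝ) 1))) := by
  have hm : AEStronglyMeasurable (fun p : V × ℝ => g (p.1 + p.2 • v))
      ((volume : Measure V).prod (volume.restrict (Ioc (0 : ℝ) 1))) :=
    Continuous.aestronglyMeasurable (by fun_prop)
  refine (integrable_prod_iff' hm).2 ⟨Filter.Eventually.of_forall fun s => by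
    simpa using hg.comp_add_right (s • v), ?_⟩
  have : ∀ s : ℝ, ∫ x, ‖g (x + s • v)‖ = ∫ x, ‖g x‖ := fun s =>
    integral_add_right_eq_self (fun x => ‖g x‖) _
  simp only [this]
  exact integrable_const _

theorem integral_intervalIntegral_add_smul {g : V → ℂ} (hg : Integrable g) (hgc : Continuous g)
    (v : V) :
    ∫ x, ∫ s in (0 : ℝ)..1, g (x + s • v) = ∫ x, g x := by
  have h := integrable_prod_comp_add_smul hg hgc v
  simp only [intervalIntegral.integral_of_le zero_le_one]
  rw [integral_integral_swap (f := fun x (s : ℝ) => g (x + s • v)) h]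
  have : ∀ s : ℝ, ∫ x, g (x + s • v) = ∫ x, g x := fun s =>
    integral_add_right_eq_self (fun x => g x) _
  simp [this]

/-- Cauchy's theorem for the integral of a holomorphic function over the real fibres of a tube. -/
theorem integral_fibre_eq_of_differentiableOn {H : V → V → ℂ} {y v : V}
    (hol : ∀ x, DifferentiableOn ℂ (fun ζ : ℂ => H (x + ζ.re • v) (y + ζ.im • v))
      (univ ×ℂ Icc 0 1))
    (hint : Integrable (fun p : V × ℝ => H p.1 (y + p.2 • v))
      ((volume : Measure V).prod (volume.restrict (Ioc (0 : ℝ) 1))))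
    (h0 : Integrable (H · y)) (h0c : Continuous (H · y))
    (h1 : Integrable (H · (y + v))) (h1c : Continuous (H · (y + v))) :
    ∫ x, H x y = ∫ x, H x (y + v) := by
  set S : V → ℂ := fun x => ∫ t in (0 : ℝ)..1, H x (y + t • v) with hS
  have hSi : Integrable S := by
    have := hint.integral_prod_left
    simpa only [hS, intervalIntegral.integral_of_le zero_le_one] using this
  have hA : Integrable (fun x => ∫ s in (0 : ℝ)..1, H (x + s • v) y) := by
    have := (integrable_prod_comp_add_smul h0 h0c v).integral_prod_left
    simpa only [intervalIntegral.integral_of_le zero_le_one] using this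
  have hB : Integrable (fun x => ∫ s in (0 : ℝ)..1, H (x + s • v) (y + v)) := by
    have := (integrable_prod_comp_add_smul h1 h1c v).integral_prod_left
    simpa only [intervalIntegral.integral_of_le zero_le_one] using this
  -- Cauchy on the unit square in the complex direction `v`: the two vertical sides are `S x` and `S
  -- (x + v)`. They cancel after integration over `x` by translation invariance, so integrability of
  -- `S` replaces any decay at infinity.
  have key : ∀ x, (∫ s in (0 : ℝ)..1, H (x + s • v) y) - (∫ s in (0 : ℝ)..1, H (x + s • v) (y + v))
      = I * S x - I * S (x + v) := by
    intro x
    have := integral_boundary_rect_eq_zero_of_differentiableOn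
      (fun ζ : ℂ => H (x + ζ.re • v) (y + ζ.im • v)) 0 (1 + I)
      ((hol x).mono (by
        rintro ζ ⟨-, h⟩
        refine ⟨mem_univ _, ?_⟩
        simpa [uIcc_of_le] using h))
    simp at this
    simp only [hS]
    linear_combination this
  have h2 := integral_congr_ae (μ := (volume : Measure V)) (Filter.Eventually.of_forall key)
  rw [integral_sub hA hB, integral_sub (hSi.const_mul _) ((hSi.comp_add_right v).const_mul _),
    integral_const_mul, integral_const_mul, integral_add_right_eq_self S v, sub_self,
    integral_intervalIntegral_add_smul h0 h0c, integral_intervalIntegral_add_smul h1 h1c] at h2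
  exact sub_eq_zero.1 h2


open RealInnerProductSpace FourierTransform

set_option linter.unusedSectionVars false

/-- The entire function `exp (-ε z·z - 2πi z·ξ)` at `z = x + iy`. -/
def gaussianKernel (ε : ℝ) (ξ x y : V) : ℂ :=
  cexp (-(ε : ℂ) * ((‖x‖ : ℂ) ^ 2 - (‖y‖ : ℂ) ^ 2 + 2 * I * (⟪x, y⟫ : ℝ))
    - 2 * Real.pi * I * ((⟪x, ξ⟫ : ℝ) + I * (⟪y, ξ⟫ : ℝ)))

theorem norm_gaussianKernel (ε : ℝ) (ξ x y : V) :
    ‖gaussianKernel ε ξ x y‖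
      = Real.exp (-ε * (‖x‖ ^ 2 - ‖y‖ ^ 2) + 2 * Real.pi * ⟪y, ξ⟫) := by
  rw [gaussianKernel, norm_exp]
  congr 1
  simp [← ofReal_pow]

@[fun_prop]
theorem continuous_gaussianKernel {X : Type*} [TopologicalSpace X] (ε : ℝ) (ξ : V) {f g : X → V}
    (hf : Continuous f) (hg : Continuous g) :
    Continuous (fun a => gaussianKernel ε ξ (f a) (g a)) := by
  unfold gaussianKernel
  fun_prop

/-- Norms and real inner products hide the holomorphy; expanding them along `v` shows that the
exponent is a quadratic polynomial in `ζ`. -/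
theorem differentiable_gaussianKernel (ε : ℝ) (ξ x y v : V) :
    Differentiable ℂ (fun ζ : ℂ => gaussianKernel ε ξ (x + ζ.re • v) (y + ζ.im • v)) := by
  have : (fun ζ : ℂ => gaussianKernel ε ξ (x + ζ.re • v) (y + ζ.im • v)) = fun ζ : ℂ =>
      cexp (-(ε : ℂ) * ((‖x‖ : ℂ) ^ 2 - (‖y‖ : ℂ) ^ 2 + 2 * I * (⟪x, y⟫ : ℝ)
        + 2 * ζ * ((⟪x, v⟫ : ℝ) + I * (⟪y, v⟫ : ℝ)) + ζ ^ 2 * (‖v‖ : ℂ) ^ 2)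
    - 2 * Real.pi * I * ((⟪x, ξ⟫ : ℝ) + I * (⟪y, ξ⟫ : ℝ) + ζ * (⟪v, ξ⟫ : ℝ))) := by
    funext ζ
    have e1 : ((‖x + ζ.re • v‖ : ℝ) : ℂ) ^ 2
        = (‖x‖ : ℂ) ^ 2 + 2 * ζ.re * (⟪x, v⟫ : ℝ) + (ζ.re : ℂ) ^ 2 * (‖v‖ : ℂ) ^ 2 := by
      rw [← ofReal_pow, norm_add_sq_real, norm_smul, real_inner_smul_right, mul_pow,
        Real.norm_eq_abs, sq_abs]
      push_cast; ring
    have e2 : ((‖y + ζ.im • v‖ : ℝ) : ℂ) ^ 2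
        = (‖y‖ : ℂ) ^ 2 + 2 * ζ.im * (⟪y, v⟫ : ℝ) + (ζ.im : ℂ) ^ 2 * (‖v‖ : ℂ) ^ 2 := by
      rw [← ofReal_pow, norm_add_sq_real, norm_smul, real_inner_smul_right, mul_pow,
        Real.norm_eq_abs, sq_abs]
      push_cast; ring
    have e3 : ((⟪x + ζ.re • v, y + ζ.im • v⟫ : ℝ) : ℂ) = (⟪x, y⟫ : ℝ) + ζ.im * (⟪x, v⟫ : ℝ)
        + ζ.re * (⟪y, v⟫ : ℝ) + ζ.re * ζ.im * (‖v‖ : ℂ) ^ 2 := by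
      simp only [inner_add_left, inner_add_right, real_inner_smul_right,
        real_inner_self_eq_norm_sq, real_inner_comm]
      rw [real_inner_comm v y]
      push_cast; ring
    rw [gaussianKernel, e1, e2, e3, inner_add_left, inner_add_left, real_inner_smul_left,
      real_inner_smul_left]
    congr 1
    push_cast
    have hζ : (ζ : ℂ) = ζ.re + ζ.im * I := (re_add_im ζ).symm
    generalize (ζ.re : ℂ) = a at *
    generalize (ζ.im : ℂ) = b at *
    subst hζ
    linear_combination (ε * b ^ 2 * (‖v‖ : ℂ) ^ 2 + 2 * ε * b * (⟪y, v⟫ : ℝ) +  0) * I_sq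
  rw [this]
  fun_prop

theorem integrable_gaussian_sq {ε : ℝ} (hε : 0 < ε) :
    Integrable (fun x : V => Real.exp (-ε * ‖x‖ ^ 2)) := by
  have := (GaussianFourier.integrable_cexp_neg_mul_sq_norm_add (V := V) (b := (ε : ℂ))
    (by simpa using hε) 0 0).norm
  refine this.congr (Filter.Eventually.of_forall fun x => ?_)
  simp [norm_exp, ← ofReal_pow]

theorem enorm_mul_le_sq_add_sq (a b : ℂ) : ‖a * b‖ₑ ≤ ‖a‖ₑ ^ 2 + ‖b‖ₑ ^ 2 := by
  rw [enorm_mul]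
  rcases le_total ‖a‖ₑ ‖b‖ₑ with h | h
  · calc ‖a‖ₑ * ‖b‖ₑ ≤ ‖b‖ₑ * ‖b‖ₑ := by gcongr
      _ = ‖b‖ₑ ^ 2 := (sq _).symm
      _ ≤ _ := le_add_self
  · calc ‖a‖ₑ * ‖b‖ₑ ≤ ‖a‖ₑ * ‖a‖ₑ := by gcongr
      _ = ‖a‖ₑ ^ 2 := (sq _).symm
      _ ≤ _ := le_self_add

/-- On a segment, the Gaussian kernel is square integrable with uniform bounds. -/
theorem exists_lintegral_gaussianKernel_le {ε : ℝ} (hε : 0 < ε) (ξ y v : V) :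
    ∃ C : ℝ≥0∞, C < ∞ ∧ ∀ t ∈ Icc (0 : ℝ) 1,
      ∫⁻ x, ‖gaussianKernel ε ξ x (y + t • v)‖ₑ ^ 2 ≤ C := by
  -- The squared modulus of the kernel splits into a fixed Gaussian in `x` and a factor depending
  -- only on `t`; `M` bounds the latter on the compact segment.
  obtain ⟨M, hM⟩ := (isCompact_Icc (a := (0 : ℝ)) (b := 1)).exists_bound_of_continuousOn
    (f := fun t : ℝ => Real.exp (2 * (ε * ‖y + t • v‖ ^ 2 + 2 * Real.pi * ⟪y + t • v, ξ⟫)))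
    (by fun_prop)
  have hi := (integrable_gaussian_sq (V := V) (ε := 2 * ε) (by positivity)).const_mul M
  refine ⟨∫⁻ x : V, ‖M * Real.exp (-(2 * ε) * ‖x‖ ^ 2)‖ₑ, hi.2, fun t ht => ?_⟩
  refine lintegral_mono fun x => ?_
  rw [← ofReal_norm, ← ofReal_norm, ← ENNReal.ofReal_pow (norm_nonneg _)]
  refine ENNReal.ofReal_le_ofReal ?_
  have h1 := hM t ht
  rw [Real.norm_of_nonneg (Real.exp_pos _).le] at h1
  have hM0 : 0 ≤ M := (Real.exp_pos _).le.trans h1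
  rw [norm_gaussianKernel, ← Real.exp_nat_mul, Real.norm_of_nonneg (by positivity)]
  calc _ = Real.exp (2 * (ε * ‖y + t • v‖ ^ 2 + 2 * Real.pi * ⟪y + t • v, ξ⟫))
        * Real.exp (-(2 * ε) * ‖x‖ ^ 2) := by
        rw [← Real.exp_add]; congr 1; push_cast; ring
    _ ≤ _ := by gcongr

/-- A function on the tube over `Ω`, written in terms of the real and imaginary part, that is
continuous, holomorphic on complex lines with real direction, and square integrable on the real
fibres, uniformly on segments of `Ω`. -/
structure IsSquareIntegrableOnTube {E : Type*} [NormedAddCommGroup E] [NormedSpace ℝ E]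
    [MeasureSpace E] (Ω : Set E) (F : E → E → ℂ) : Prop where
  continuousOn : ContinuousOn (fun p : E × E => F p.1 p.2) (univ ×ˢ Ω)
  differentiableOn : ∀ x y v, y ∈ Ω → y + v ∈ Ω →
    DifferentiableOn ℂ (fun ζ : ℂ => F (x + ζ.re • v) (y + ζ.im • v)) (univ ×ℂ Icc 0 1)
  lintegral_le : ∀ y v, y ∈ Ω → y + v ∈ Ω →
    ∃ C : ℝ≥0∞, C < ∞ ∧ ∀ t ∈ Icc (0 : ℝ) 1, ∫⁻ x, ‖F x (y + t • v)‖ₑ ^ 2 ≤ C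

namespace IsSquareIntegrableOnTube

variable {Ω : Set V} {F : V → V → ℂ}

theorem continuous_fibre (hF : IsSquareIntegrableOnTube Ω F) {y : V} (hy : y ∈ Ω) :
    Continuous (F · y) := by
  have := hF.continuousOn.comp (f := fun x : V => (x, y)) (s := univ) (by fun_prop)
    (fun x _ => ⟨mem_univ _, hy⟩)
  exact continuousOn_univ.1 this

theorem lintegral_lt_top (hF : IsSquareIntegrableOnTube Ω F) {y : V} (hy : y ∈ Ω) :
    ∫⁻ x, ‖F x y‖ₑ ^ 2 < ∞ := by
  obtain ⟨C, hC, h⟩ := hF.lintegral_le y 0 hy (by simpa)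
  simpa using (h 0 (by simp)).trans_lt hC

theorem memLp (hF : IsSquareIntegrableOnTube Ω F) {y : V} (hy : y ∈ Ω) : MemLp (F · y) 2 :=
  (memLp_two_iff_lintegral (hF.continuous_fibre hy).aestronglyMeasurable).2
    (hF.lintegral_lt_top hy)

theorem continuous_mul_gaussianKernel (hF : IsSquareIntegrableOnTube Ω F) (ε : ℝ) (ξ : V)
    {y : V} (hy : y ∈ Ω) : Continuous (fun x => F x y * gaussianKernel ε ξ x y) :=
  (hF.continuous_fibre hy).mul (by fun_prop)

theorem integrable_mul_gaussianKernel (hF : IsSquareIntegrableOnTube Ω F) {ε : ℝ} (hε : 0 < ε)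
    (ξ : V) {y : V} (hy : y ∈ Ω) : Integrable (fun x => F x y * gaussianKernel ε ξ x y) := by
  refine ⟨(hF.continuous_mul_gaussianKernel ε ξ hy).aestronglyMeasurable, ?_⟩
  obtain ⟨C, hC, h⟩ := exists_lintegral_gaussianKernel_le hε ξ y 0
  have h0 := h 0 (by simp)
  simp only [smul_zero, add_zero] at h0
  calc _ ≤ ∫⁻ x, (‖F x y‖ₑ ^ 2 + ‖gaussianKernel ε ξ x y‖ₑ ^ 2) :=
        lintegral_mono fun x => enorm_mul_le_sq_add_sq _ _
    _ = (∫⁻ x, ‖F x y‖ₑ ^ 2) + ∫⁻ x, ‖gaussianKernel ε ξ x y‖ₑ ^ 2 :=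
        lintegral_add_left ((hF.continuous_fibre hy).enorm.measurable.pow_const 2) _
    _ < ∞ := ENNReal.add_lt_top.2 ⟨hF.lintegral_lt_top hy, h0.trans_lt hC⟩

/-- The fibres of `F` are only square integrable; multiplying by an entire Gaussian makes them
integrable without losing holomorphy, so the Cauchy shift applies. This is the link between the
Fourier transforms of different fibres. -/
theorem integral_mul_gaussianKernel_eq (hΩ : Convex ℝ Ω) (hF : IsSquareIntegrableOnTube Ω F)
    {ε : ℝ} (hε : 0 < ε) (ξ : V) {y y' : V} (hy : y ∈ Ω) (hy' : y' ∈ Ω) :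
    ∫ x, F x y * gaussianKernel ε ξ x y = ∫ x, F x y' * gaussianKernel ε ξ x y' := by
  obtain ⟨v, rfl⟩ : ∃ v, y' = y + v := ⟨y' - y, by abel⟩
  have hseg : ∀ t ∈ Icc (0 : ℝ) 1, y + t • v ∈ Ω := fun t ht => by
    have := hΩ.add_smul_sub_mem hy hy' ht
    simpa using this
  refine integral_fibre_eq_of_differentiableOn (H := fun x y => F x y * gaussianKernel ε ξ x y)
    (fun x => (hF.differentiableOn x y v hy hy').mul
      (differentiable_gaussianKernel ε ξ x y v).differentiableOn) ?_
    (hF.integrable_mul_gaussianKernel hε ξ hy) (hF.continuous_mul_gaussianKernel ε ξ hy)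
    (hF.integrable_mul_gaussianKernel hε ξ hy') (hF.continuous_mul_gaussianKernel ε ξ hy')
  have hm : AEStronglyMeasurable (fun p : V × ℝ => F p.1 (y + p.2 • v)
      * gaussianKernel ε ξ p.1 (y + p.2 • v))
      ((volume : Measure V).prod (volume.restrict (Ioc (0 : ℝ) 1))) := by
    have h1 : ContinuousOn (fun p : V × ℝ => F p.1 (y + p.2 • v)) (univ ×ˢ Icc 0 1) :=
      hF.continuousOn.comp (f := fun p : V × ℝ => (p.1, y + p.2 • v)) (by fun_prop)
        fun p hp => ⟨mem_univ _, hseg _ hp.2⟩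
    have h2 : Continuous (fun p : V × ℝ => gaussianKernel ε ξ p.1 (y + p.2 • v)) := by fun_prop
    have h3 := ((h1.mul h2.continuousOn).mono
      (prod_mono subset_rfl Ioc_subset_Icc_self)).aestronglyMeasurable
      (μ := (volume : Measure V).prod (volume : Measure ℝ)) (MeasurableSet.univ.prod measurableSet_Ioc)
    rwa [← Measure.prod_restrict, Measure.restrict_univ] at h3
  refine ⟨hm, ?_⟩
  obtain ⟨C, hC, h⟩ := exists_lintegral_gaussianKernel_le hε ξ y v
  obtain ⟨C', hC', h'⟩ := hF.lintegral_le y v hy hy'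
  rw [HasFiniteIntegral, lintegral_prod_symm _ hm.enorm]
  calc _ ≤ ∫⁻ t in Ioc (0 : ℝ) 1, (C' + C) := by
        refine setLIntegral_mono measurable_const fun t ht => ?_
        have ht' := Ioc_subset_Icc_self ht
        calc _ ≤ ∫⁻ x, (‖F x (y + t • v)‖ₑ ^ 2 + ‖gaussianKernel ε ξ x (y + t • v)‖ₑ ^ 2) :=
              lintegral_mono fun x => enorm_mul_le_sq_add_sq _ _
          _ = (∫⁻ x, ‖F x (y + t • v)‖ₑ ^ 2) + ∫⁻ x, ‖gaussianKernel ε ξ x (y + t • v)‖ₑ ^ 2 :=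
              lintegral_add_left
                ((hF.continuous_fibre (hseg t ht')).enorm.measurable.pow_const 2) _
          _ ≤ C' + C := add_le_add (h' t ht') (h t ht')
    _ < ∞ := by simp [hC, hC']

end IsSquareIntegrableOnTube

end TubeShift

/-! ### Paley–Wiener for square integrable holomorphic functions on tubes. -/

section TubeFourier

open Set RealInnerProductSpace FourierTransform Filter Topology

variable {V : Type*} [NormedAddCommGroup V] [InnerProductSpace ℝ V] [FiniteDimensional ℝ V]
  [MeasurableSpace V] [BorelSpace V]

set_option linter.unusedSectionVars false

/-- This isolates the growth factor and the Fourier character, leaving the regularizer at frequency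
`0`, which tends to `1` as `ε → 0`. -/
theorem gaussianKernel_eq_mul (ε : ℝ) (ξ x y : V) :
    gaussianKernel ε ξ x y = (Real.exp (2 * Real.pi * ⟪y, ξ⟫) : ℂ) *
      (cexp (↑(-2 * Real.pi * ⟪x, ξ⟫) * I) * gaussianKernel ε 0 x y) := by
  simp only [gaussianKernel, ofReal_exp, ← Complex.exp_add]
  congr 1
  simp only [inner_zero_right]
  push_cast
  linear_combination (-2 * Real.pi * (⟪y, ξ⟫ : ℝ)) * I_sq

theorem tendsto_gaussianKernel_zero (x y : V) :
    Tendsto (fun n : ℕ => gaussianKernel (1 / ((n : ℝ) + 1)) 0 x y) atTop (𝓝 1) := by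
  have h1 : Continuous (fun ε : ℝ => gaussianKernel ε 0 x y) := by
    unfold gaussianKernel; fun_prop
  have h2 := (h1.tendsto 0).comp tendsto_one_div_add_atTop_nhds_zero_nat
  simpa [gaussianKernel, Function.comp_def] using h2

theorem norm_gaussianKernel_zero_le {ε : ℝ} (h0 : 0 ≤ ε) (h1 : ε ≤ 1) (x y : V) :
    ‖gaussianKernel ε 0 x y‖ ≤ Real.exp (‖y‖ ^ 2) := by
  rw [norm_gaussianKernel]
  refine Real.exp_le_exp.2 ?_
  simp only [inner_zero_right, mul_zero, add_zero]
  nlinarith [mul_nonneg h0 (sq_nonneg ‖x‖), mul_nonneg (sub_nonneg.2 h1) (sq_nonneg ‖y‖)]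

namespace IsSquareIntegrableOnTube

variable {Ω : Set V} {F : V → V → ℂ}

theorem tendsto_lintegral_mul_gaussianKernel_sub (hF : IsSquareIntegrableOnTube Ω F) {y : V}
    (hy : y ∈ Ω) :
    Tendsto (fun n : ℕ => ∫⁻ x, ‖F x y * gaussianKernel (1 / ((n : ℝ) + 1)) 0 x y - F x y‖ₑ ^ 2)
      atTop (𝓝 0) := by
  have hc := hF.continuous_fibre hy
  have := tendsto_lintegral_of_dominated_convergence (μ := (volume : Measure V))
    (F := fun (n : ℕ) x => ‖F x y * gaussianKernel (1 / ((n : ℝ) + 1)) 0 x y - F x y‖ₑ ^ 2)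
    (f := fun _ => 0)
    (fun x => ENNReal.ofReal (Real.exp (‖y‖ ^ 2) + 1) ^ 2 * ‖F x y‖ₑ ^ 2)
    (fun n => by
      have : Continuous fun x => F x y * gaussianKernel (1 / ((n : ℝ) + 1)) 0 x y - F x y := by
        fun_prop
      exact this.enorm.measurable.pow_const 2)
    (fun n => Eventually.of_forall fun x => by
      beta_reduce
      rw [← mul_pow]
      gcongr
      rw [← ofReal_norm, ← ofReal_norm, ← ENNReal.ofReal_mul (by positivity)]
      refine ENNReal.ofReal_le_ofReal ?_
      have h := norm_gaussianKernel_zero_le (ε := 1 / ((n : ℝ) + 1)) (by positivity)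
        (by rw [div_le_one (by positivity)]; linarith [n.cast_nonneg (α := ℝ)]) x y
      calc _ = ‖gaussianKernel (1 / ((n : ℝ) + 1)) 0 x y - 1‖ * ‖F x y‖ := by
            rw [← norm_mul]; congr 1; ring
        _ ≤ _ := by
            gcongr
            exact (norm_sub_le _ _).trans (by simpa using h))
    (by
      rw [lintegral_const_mul _ (hc.enorm.measurable.pow_const 2)]
      exact (ENNReal.mul_lt_top (by finiteness) (hF.lintegral_lt_top hy)).ne)
    (Eventually.of_forall fun x => by
      have h1 := ((tendsto_gaussianKernel_zero x y).const_mul (F x y)).sub_const (F x y)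
      have h2 := h1.enorm
      rw [mul_one, sub_self, enorm_zero] at h2
      simpa [Function.comp_def] using (ENNReal.continuous_pow 2).tendsto _ |>.comp h2)
  simpa using this

theorem memLp_mul_gaussianKernel (hF : IsSquareIntegrableOnTube Ω F) {y : V} (hy : y ∈ Ω) (n : ℕ) :
    MemLp (fun x => F x y * gaussianKernel (1 / ((n : ℝ) + 1)) 0 x y) 2 := by
  refine (hF.memLp hy).of_le_mul (c := Real.exp (‖y‖ ^ 2))
    (hF.continuous_mul_gaussianKernel _ _ hy).aestronglyMeasurable
    (Eventually.of_forall fun x => ?_)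
  rw [norm_mul, mul_comm]
  gcongr
  exact norm_gaussianKernel_zero_le (by positivity)
        (by rw [div_le_one (by positivity)]; linarith [n.cast_nonneg (α := ℝ)]) x y

/-- Along a subsequence, the Fourier integrals of the Gaussian regularizations converge almost
everywhere to the `L²` Fourier transform of a fibre. -/
theorem exists_subseq_tendsto (hF : IsSquareIntegrableOnTube Ω F) {y : V} (hy : y ∈ Ω) {φ : ℕ → ℕ}
    (hφ : StrictMono φ) :
    ∃ ψ : ℕ → ℕ, StrictMono ψ ∧ ∀ᵐ ξ : V, Tendsto (fun n => (∫ x, F x y *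
        gaussianKernel (1 / ((φ (ψ n) : ℝ) + 1)) ξ x y)) atTop
      (𝓝 ((Real.exp (2 * Real.pi * ⟪y, ξ⟫) : ℂ) *
        (𝓕 ((hF.memLp hy).toLp _) : Lp ℂ 2 (volume : Measure V)) ξ)) := by
  have hlim : Tendsto (fun n : ℕ => (hF.memLp_mul_gaussianKernel hy n).toLp _) atTop
      (𝓝 ((hF.memLp hy).toLp _)) := by
    rw [Lp.tendsto_Lp_iff_tendsto_eLpNorm'']
    have h := hF.tendsto_lintegral_mul_gaussianKernel_sub hy
    simp only [lintegral_enorm_sq_eq_eLpNorm_sq] at h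
    have h2 := (ENNReal.continuous_rpow_const (y := 1 / 2)).tendsto _ |>.comp h
    refine (h2.congr fun n => ?_).trans_eq ?_
    · simp only [Function.comp_apply]
      rw [← ENNReal.rpow_natCast, ← ENNReal.rpow_mul]
      norm_num
      rfl
    · simp
  -- Extraction starts from a prescribed subsequence `φ`, so that two fibres can later be handled
  -- along a common one.
  have hlim2 := ((continuous_fourier (E := Lp ℂ 2 (volume : Measure V))).tendsto _).comp
    (hlim.comp hφ.tendsto_atTop)
  obtain ⟨ψ, hψ, h⟩ := (tendstoInMeasure_of_tendsto_Lp hlim2).exists_seq_tendsto_ae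
  refine ⟨ψ, hψ, ?_⟩
  have hae : ∀ᵐ ξ : V, ∀ n : ℕ, (𝓕 ((hF.memLp_mul_gaussianKernel hy n).toLp _) :
      Lp ℂ 2 (volume : Measure V)) ξ
      = 𝓕 (fun x => F x y * gaussianKernel (1 / ((n : ℝ) + 1)) 0 x y) ξ :=
    ae_all_iff.2 fun n => coeFn_fourier_toLp_ae_eq
      (hF.integrable_mul_gaussianKernel (by positivity) 0 hy) _
  filter_upwards [h, hae] with ξ h1 h2
  refine (h1.const_mul ((Real.exp (2 * Real.pi * ⟪y, ξ⟫) : ℂ))).congr fun n => ?_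
  simp only [Function.comp_apply, h2, Real.fourier_eq', smul_eq_mul]
  rw [← integral_const_mul]
  congr 1
  funext x
  rw [gaussianKernel_eq_mul _ ξ]
  ring

/-- A Paley--Wiener type theorem: square integrable holomorphic functions on tubes are
Fourier--Laplace integrals. -/
theorem exists_fourier_repr (hΩ : Convex ℝ Ω) (hne : Ω.Nonempty)
    (hF : IsSquareIntegrableOnTube Ω F) :
    ∃ f : V → ℂ, Measurable f ∧ ∀ y ∈ Ω,
      (∫⁻ ξ, ‖f ξ‖ₑ ^ 2 * ENNReal.ofReal (Real.exp (-4 * Real.pi * ⟪y, ξ⟫)) = ∫⁻ x, ‖F x y‖ₑ ^ 2) ∧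
      (Integrable (fun ξ => (Real.exp (-2 * Real.pi * ⟪y, ξ⟫) : ℂ) * f ξ) → ∀ x, F x y
        = ∫ ξ, cexp (2 * Real.pi * I * ((⟪x, ξ⟫ : ℝ) + I * (⟪y, ξ⟫ : ℝ))) * f ξ) := by
  obtain ⟨y₀, hy₀⟩ := hne
  -- The density is read off a single reference fibre `y₀` by undoing its exponential damping.
  set f : V → ℂ := fun ξ => (Real.exp (2 * Real.pi * ⟪y₀, ξ⟫) : ℂ) *
        (𝓕 ((hF.memLp hy₀).toLp _) : Lp ℂ 2 (volume : Measure V)) ξ with hf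
  have hfm : Measurable f := by
    refine Measurable.mul (by fun_prop) (Lp.stronglyMeasurable _).measurable
  refine ⟨f, hfm, fun y hy => ?_⟩
  -- The density does not depend on the reference fibre: along a common subsequence the regularized
  -- integrals at `y` and `y₀` are equal, hence so are their limits.
  have hfy : (fun ξ => (Real.exp (-2 * Real.pi * ⟪y, ξ⟫) : ℂ) * f ξ) =ᵐ[volume]
      (𝓕 ((hF.memLp hy).toLp _) : Lp ℂ 2 (volume : Measure V)) := by
    obtain ⟨φ, hφ, h1⟩ := hF.exists_subseq_tendsto hy₀ strictMono_id
    obtain ⟨ψ, hψ, h2⟩ := hF.exists_subseq_tendsto hy hφ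
    filter_upwards [h1, h2] with ξ h1 h2
    have h3 := tendsto_nhds_unique (h2.congr fun n =>
      hF.integral_mul_gaussianKernel_eq hΩ (by positivity) ξ hy hy₀) (h1.comp hψ.tendsto_atTop)
    rw [hf]
    simp only
    rw [← h3, ← mul_assoc, ← ofReal_mul, ← Real.exp_add]
    simp
  have hmem : MemLp (fun ξ => (Real.exp (-2 * Real.pi * ⟪y, ξ⟫) : ℂ) * f ξ) 2 :=
    (memLp_congr_ae hfy).2 (Lp.memLp _)
  clear_value f
  refine ⟨?_, fun hi x => ?_⟩
  · have h1 : ∫⁻ x, ‖F x y‖ₑ ^ 2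
        = ∫⁻ ξ, ‖(Real.exp (-2 * Real.pi * ⟪y, ξ⟫) : ℂ) * f ξ‖ₑ ^ 2 := by
      rw [lintegral_enorm_sq_eq_eLpNorm_sq, lintegral_enorm_sq_eq_eLpNorm_sq, eLpNorm_congr_ae hfy,
        ← Lp.enorm_def, ← eLpNorm_congr_ae (hF.memLp hy).coeFn_toLp, ← Lp.enorm_def]
      congr 1
      rw [← ofReal_norm, ← ofReal_norm, Lp.norm_fourier_eq]
    rw [h1]
    refine lintegral_congr fun ξ => ?_
    rw [enorm_mul, mul_pow, mul_comm, ← ofReal_norm (Real.exp _ : ℂ), norm_real,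
      Real.norm_of_nonneg (Real.exp_pos _).le, ← ENNReal.ofReal_pow (Real.exp_pos _).le,
      ← Real.exp_nat_mul]
    congr 3
    push_cast; ring
  · have h1 : hmem.toLp _ = (𝓕 ((hF.memLp hy).toLp _) : Lp ℂ 2 (volume : Measure V)) := by
      refine Lp.ext ?_
      filter_upwards [hmem.coeFn_toLp, hfy] with ξ h1 h2
      rw [h1, h2]
    have h2 : (F · y) =ᵐ[volume] 𝓕⁻ (fun ξ => (Real.exp (-2 * Real.pi * ⟪y, ξ⟫) : ℂ) * f ξ) := by
      have h3 := coeFn_fourierInv_toLp_ae_eq hi hmem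
      rw [h1, fourierInv_fourier_eq] at h3
      exact (hF.memLp hy).coeFn_toLp.symm.trans h3
    have hcont : Continuous (𝓕⁻ (fun ξ => (Real.exp (-2 * Real.pi * ⟪y, ξ⟫) : ℂ) * f ξ)) :=
      VectorFourier.fourierIntegral_continuous (L := -innerₗ V) Real.continuous_fourierChar
        (by exact continuous_inner.neg) hi
    -- Both sides are continuous in `x`, so equality almost everywhere is equality everywhere.
    have h4 := congrFun ((Continuous.ae_eq_iff_eq _ (hF.continuous_fibre hy) hcont).1 h2) x
    rw [h4, Real.fourierInv_eq']
    congr 1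
    funext ξ
    rw [smul_eq_mul, ← mul_assoc, ofReal_exp, ← Complex.exp_add, real_inner_comm]
    congr 2
    push_cast
    linear_combination (-2 * Real.pi * (⟪y, ξ⟫ : ℝ)) * I_sq

end IsSquareIntegrableOnTube

end TubeFourier

/-! ### Transport of the tube results to spaces whose norm is not Euclidean. -/

section Transfer

open Set RealInnerProductSpace FourierTransform Filter Topology

variable {V : Type*} [NormedAddCommGroup V] [InnerProductSpace ℝ V] [FiniteDimensional ℝ V]
  [MeasurableSpace V] [BorelSpace V]
  {E : Type*} [NormedAddCommGroup E] [NormedSpace ℝ E] [MeasureSpace E] [BorelSpace E]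

/-- Products such as `ℝ × ℝ` carry the sup norm, while the Fourier theory needs an inner product; a
measure preserving linear equivalence bridges the two. -/
theorem IsSquareIntegrableOnTube.comp_symm {L : E ≃L[ℝ] V}
    (hL : MeasurePreserving L) {Ω : Set E} {F : E → E → ℂ}
    (hF : IsSquareIntegrableOnTube Ω F) :
    IsSquareIntegrableOnTube (L.symm ⁻¹' Ω) (fun x y => F (L.symm x) (L.symm y)) where
  continuousOn := hF.continuousOn.comp (f := fun p : V × V => (L.symm p.1, L.symm p.2))
    (by fun_prop) fun p hp => ⟨mem_univ _, hp.2⟩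
  differentiableOn x y v hy hv := by
    have := hF.differentiableOn (L.symm x) (L.symm y) (L.symm v) hy (by simpa using hv)
    simpa using this
  lintegral_le y v hy hv := by
    obtain ⟨C, hC, h⟩ := hF.lintegral_le (L.symm y) (L.symm v) hy (by simpa using hv)
    refine ⟨C, hC, fun t ht => ?_⟩
    rw [← hL.lintegral_comp_emb L.toHomeomorph.measurableEmbedding]
    simpa using h t ht

theorem IsSquareIntegrableOnTube.exists_fourier_repr_of_equiv {L : E ≃L[ℝ] V}
    (hL : MeasurePreserving L) {Ω : Set E} (hΩ : Convex ℝ Ω) (hne : Ω.Nonempty) {F : E → E → ℂ}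
    (hF : IsSquareIntegrableOnTube Ω F) :
    ∃ f : E → ℂ, Measurable f ∧ ∀ y ∈ Ω,
      (∫⁻ ξ, ‖f ξ‖ₑ ^ 2 * ENNReal.ofReal (Real.exp (-4 * Real.pi * ⟪L y, L ξ⟫))
        = ∫⁻ x, ‖F x y‖ₑ ^ 2) ∧
      (Integrable (fun ξ => (Real.exp (-2 * Real.pi * ⟪L y, L ξ⟫) : ℂ) * f ξ) → ∀ x, F x y
        = ∫ ξ, cexp (2 * Real.pi * I * ((⟪L x, L ξ⟫ : ℝ) + I * (⟪L y, L ξ⟫ : ℝ))) * f ξ) := by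
  have hemb := L.toHomeomorph.measurableEmbedding
  obtain ⟨f, hf, h⟩ := (hF.comp_symm hL).exists_fourier_repr
    (hΩ.linear_preimage (L.symm : V →ₗ[ℝ] E)) (by
      obtain ⟨y, hy⟩ := hne
      exact ⟨L y, by simpa using hy⟩)
  refine ⟨f ∘ L, hf.comp L.continuous.measurable, fun y hy => ?_⟩
  obtain ⟨h1, h2⟩ := h (L y) (by simpa using hy)
  refine ⟨?_, fun hi x => ?_⟩
  · rw [← hL.lintegral_comp_emb hemb, ← hL.lintegral_comp_emb hemb] at h1
    simpa using h1
  · have h3 := h2 ((hL.integrable_comp_emb hemb).1 hi) (L x)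
    rw [← hL.integral_comp hemb] at h3
    simpa using h3

theorem lintegral_fourierInv_sq_le_of_equiv {L : E ≃L[ℝ] V} (hL : MeasurePreserving L) {h : E → ℂ}
    (hh : Integrable h) :
    ∫⁻ x, ‖∫ ξ, cexp (2 * Real.pi * I * (⟪L x, L ξ⟫ : ℝ)) * h ξ‖ₑ ^ 2 ≤ ∫⁻ ξ, ‖h ξ‖ₑ ^ 2 := by
  have hemb := L.toHomeomorph.measurableEmbedding
  have hh' : Integrable (h ∘ L.symm) := by
    rw [← hL.integrable_comp_emb hemb]
    simpa [Function.comp_def] using hh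
  have h1 := lintegral_fourierInv_sq_le hh'
  rw [← hL.lintegral_comp_emb hemb, ← hL.lintegral_comp_emb hemb] at h1
  refine (le_of_eq (lintegral_congr fun x => ?_)).trans (h1.trans_eq (by simp))
  rw [Real.fourierInv_eq', ← hL.integral_comp hemb]
  congr 3
  funext ξ
  rw [real_inner_comm]
  simp only [Function.comp_apply, ContinuousLinearEquiv.symm_apply_apply, smul_eq_mul]
  push_cast
  congr 2
  ring

end Transfer

/-! ### Euclidean models of `ℝ²` and `ℝ³`. -/

section Coordinates

open RealInnerProductSpace

/-- `ℝ²` with the Euclidean structure. -/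
def euclideanTwo : (ℝ × ℝ) ≃L[ℝ] WithLp 2 (ℝ × ℝ) := (WithLp.prodContinuousLinearEquiv 2 ℝ ℝ ℝ).symm

theorem measurePreserving_euclideanTwo : MeasurePreserving euclideanTwo :=
  WithLp.volume_preserving_toLp ℝ ℝ

theorem inner_euclideanTwo (x y : ℝ × ℝ) :
    ⟪euclideanTwo x, euclideanTwo y⟫ = x.1 * y.1 + x.2 * y.2 := by
  simp [euclideanTwo, WithLp.prod_inner_apply, mul_comm]

/-- `ℝ³` with the Euclidean structure. -/
def euclideanThree : R3 ≃L[ℝ] WithLp 2 (WithLp 2 (ℝ × ℝ) × ℝ) :=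
  (euclideanTwo.prodCongr (ContinuousLinearEquiv.refl ℝ ℝ)).trans
    (WithLp.prodContinuousLinearEquiv 2 ℝ (WithLp 2 (ℝ × ℝ)) ℝ).symm

theorem measurePreserving_euclideanThree : MeasurePreserving euclideanThree :=
  (WithLp.volume_preserving_toLp (WithLp 2 (ℝ × ℝ)) ℝ).comp
    (measurePreserving_euclideanTwo.prod (MeasurePreserving.id volume))

/-- The standard scalar product of `ℝ³`. -/
def dot3 (x y : R3) : ℝ := x.1.1 * y.1.1 + x.1.2 * y.1.2 + x.2 * y.2

theorem inner_euclideanThree (x y : R3) : ⟪euclideanThree x, euclideanThree y⟫ = dot3 x y := by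
  have := inner_euclideanTwo x.1 y.1
  simp only [dot3, ← this]
  simp [euclideanThree, WithLp.prod_inner_apply, mul_comm]

/-- The complex bilinear extension of the standard scalar product of `ℝ³`. -/
def cdot3 (z : C3) (ξ : R3) : ℂ := z.1.1 * ξ.1.1 + z.1.2 * ξ.1.2 + z.2 * ξ.2

theorem cdot3_tubePoint (x y ξ : R3) : cdot3 (tubePoint x y) ξ = dot3 x ξ + I * dot3 y ξ := by
  simp only [cdot3, tubePoint, dot3]
  push_cast
  ring

end Coordinates

/-! ### Fourier–Laplace integrals and the symbol of the box operator. -/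

section FourierLaplace

open Set Filter Topology

/-- The term of order `n = dim E + 1` in the exponential series bounds `e^{-a‖x‖}` by a multiple of
`(1 + ‖x‖)^(-n)`, which is integrable. -/
theorem integrable_exp_neg_mul_norm {E : Type*} [NormedAddCommGroup E] [NormedSpace ℝ E]
    [FiniteDimensional ℝ E] [MeasurableSpace E] [BorelSpace E] (μ : Measure E)
    [μ.IsAddHaarMeasure] {a : ℝ} (ha : 0 < a) : Integrable (fun x => Real.exp (-a * ‖x‖)) μ := by
  set n := Module.finrank ℝ E + 1 with hn
  have h := (integrable_one_add_norm (μ := μ) (E := E) (r := n) (by simp [hn])).const_mul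
    (n.factorial * Real.exp a / a ^ n)
  refine h.mono' (by fun_prop) (Eventually.of_forall fun x => ?_)
  have h1 := Real.pow_div_factorial_le_exp (a * (1 + ‖x‖)) (by positivity) n
  rw [Real.norm_of_nonneg (Real.exp_pos _).le, Real.rpow_neg (by positivity), Real.rpow_natCast,
    ← div_eq_mul_inv, div_div, le_div_iff₀ (by positivity)]
  rw [div_le_iff₀ (by positivity), mul_pow] at h1
  calc _ ≤ Real.exp (-a * ‖x‖) * (Real.exp (a * (1 + ‖x‖)) * n.factorial) := by gcongr
    _ = _ := by
      rw [← mul_assoc, ← Real.exp_add, mul_comm]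
      congr 2
      ring

theorem norm_components_le (ξ : R3) : |ξ.1.1| ≤ ‖ξ‖ ∧ |ξ.1.2| ≤ ‖ξ‖ ∧ |ξ.2| ≤ ‖ξ‖ :=
  ⟨(norm_fst_le ξ.1).trans (norm_fst_le ξ), (norm_snd_le ξ.1).trans (norm_fst_le ξ),
    norm_snd_le ξ⟩

theorem norm_cdot3_le (z : C3) (ξ : R3) : ‖cdot3 z ξ‖ ≤ 3 * ‖ξ‖ * ‖z‖ := by
  obtain ⟨h1, h2, h3⟩ := norm_components_le ξ
  have k1 : ‖z.1.1‖ ≤ ‖z‖ := (norm_fst_le z.1).trans (norm_fst_le z)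
  have k2 : ‖z.1.2‖ ≤ ‖z‖ := (norm_snd_le z.1).trans (norm_fst_le z)
  have k3 : ‖z.2‖ ≤ ‖z‖ := norm_snd_le z
  calc ‖cdot3 z ξ‖ ≤ ‖z.1.1 * ξ.1.1‖ + ‖z.1.2 * ξ.1.2‖ + ‖z.2 * ξ.2‖ := norm_add₃_le
    _ = ‖z.1.1‖ * |ξ.1.1| + ‖z.1.2‖ * |ξ.1.2| + ‖z.2‖ * |ξ.2| := by
      simp only [norm_mul, norm_real, Real.norm_eq_abs]
    _ ≤ ‖z‖ * ‖ξ‖ + ‖z‖ * ‖ξ‖ + ‖z‖ * ‖ξ‖ := by gcongr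
    _ = _ := by ring

/-- `cdot3 · ξ` as a continuous linear form. -/
def cdot3CLM (ξ : R3) : C3 →L[ℂ] ℂ :=
  LinearMap.mkContinuous
    { toFun := fun z => cdot3 z ξ
      map_add' := fun z w => by simp [cdot3]; ring
      map_smul' := fun c z => by simp [cdot3]; ring }
    (3 * ‖ξ‖) (fun z => norm_cdot3_le z ξ)

@[simp] theorem cdot3CLM_apply (ξ : R3) (z : C3) : cdot3CLM ξ z = cdot3 z ξ := rfl

theorem norm_cdot3CLM_le (ξ : R3) : ‖cdot3CLM ξ‖ ≤ 3 * ‖ξ‖ :=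
  LinearMap.mkContinuous_norm_le _ (by positivity) _

theorem continuous_cdot3CLM : Continuous cdot3CLM := by
  have : cdot3CLM = fun ξ : R3 =>
      (ξ.1.1 : ℂ) • ((ContinuousLinearMap.fst ℂ ℂ ℂ).comp (ContinuousLinearMap.fst ℂ (ℂ × ℂ) ℂ))
      + (ξ.1.2 : ℂ) • ((ContinuousLinearMap.snd ℂ ℂ ℂ).comp (ContinuousLinearMap.fst ℂ (ℂ × ℂ) ℂ))
      + (ξ.2 : ℂ) • (ContinuousLinearMap.snd ℂ (ℂ × ℂ) ℂ) := by
    funext ξ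
    refine ContinuousLinearMap.ext fun z => ?_
    simp [cdot3, mul_comm]
  rw [this]
  fun_prop

@[fun_prop]
theorem continuous_cdot3_right (z : C3) : Continuous (fun ξ => cdot3 z ξ) := by
  unfold cdot3; fun_prop

@[fun_prop]
theorem continuous_dot3_right (y : R3) : Continuous (fun ξ => dot3 y ξ) := by
  unfold dot3; fun_prop

theorem im_cdot3 (z : C3) (ξ : R3) : (cdot3 z ξ).im = dot3 (imPart z) ξ := by
  simp [cdot3, dot3, imPart]

theorem norm_cexp_cdot3 (z : C3) (ξ : R3) :
    ‖cexp (2 * Real.pi * I * cdot3 z ξ)‖ = Real.exp (-2 * Real.pi * dot3 (imPart z) ξ) := by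
  rw [norm_exp, ← im_cdot3]
  congr 1
  simp

/-- The Fourier--Laplace integral of a function on `ℝ³`. -/
def fourierLaplace (f : R3 → ℂ) (z : C3) : ℂ := ∫ ξ, cexp (2 * Real.pi * I * cdot3 z ξ) * f ξ

/-- Functions whose Fourier--Laplace integral converges locally uniformly on the tube domain. -/
structure IsLaplaceAdmissible (f : R3 → ℂ) : Prop where
  aestronglyMeasurable : AEStronglyMeasurable f
  integrable : ∀ y ∈ sphericalCone, ∃ δ > 0,
    Integrable (fun ξ => Real.exp (-2 * Real.pi * dot3 y ξ + δ * ‖ξ‖) * ‖f ξ‖)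

theorem norm_le_inv_mul_exp {δ : ℝ} (hδ : 0 < δ) (ξ : R3) :
    ‖ξ‖ ≤ 1 / δ * Real.exp (δ * ‖ξ‖) := by
  rw [one_div, ← div_eq_inv_mul, le_div_iff₀ hδ, mul_comm]
  linarith [Real.add_one_le_exp (δ * ‖ξ‖)]

theorem isOpen_sphericalCone : IsOpen sphericalCone := by
  have h : sphericalCone = {y | 0 < coneDet y} ∩ {y | 0 < y.1.1} := rfl
  rw [h]
  unfold coneDet
  exact (isOpen_lt (by fun_prop) (by fun_prop)).inter (isOpen_lt (by fun_prop) (by fun_prop))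

theorem isOpen_tubeDomain : IsOpen tubeDomain := by
  have : Continuous imPart := by unfold imPart; fun_prop
  exact isOpen_sphericalCone.preimage this

/-- The symbol of the box operator in the coordinates of `fourierLaplace`. -/
def boxSymbol (ξ : R3) : ℝ := 4 * Real.pi ^ 2 * (4 * ξ.1.1 * ξ.1.2 - ξ.2 ^ 2)

theorem fourierLaplace_const_mul (c : ℂ) (f : R3 → ℂ) (z : C3) :
    fourierLaplace (fun ξ => c * f ξ) z = c * fourierLaplace f z := by
  rw [fourierLaplace, fourierLaplace, ← integral_const_mul]
  congr 1
  funext ξ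
  ring

namespace IsLaplaceAdmissible

variable {f : R3 → ℂ}

/-- Half of the exponential slack `δ` absorbs the linear growth and the other half remains, so the
class can be multiplied by linear forms repeatedly. -/
theorem mul_of_norm_le (hf : IsLaplaceAdmissible f) {a : R3 → ℂ} (ha : Continuous a) {K : ℝ}
    (hK : ∀ ξ, ‖a ξ‖ ≤ K * ‖ξ‖) : IsLaplaceAdmissible (fun ξ => a ξ * f ξ) where
  aestronglyMeasurable := ha.aestronglyMeasurable.mul hf.aestronglyMeasurable
  integrable y hy := by
    obtain ⟨δ, hδ, h⟩ := hf.integrable y hy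
    refine ⟨δ / 2, by positivity, (h.const_mul (|K| * (1 / (δ / 2)))).mono'
      (by have := hf.aestronglyMeasurable; have := this.norm; fun_prop)
      (Eventually.of_forall fun ξ => ?_)⟩
    rw [Real.norm_of_nonneg (by positivity), norm_mul]
    have h1 : ‖a ξ‖ ≤ |K| * (1 / (δ / 2) * Real.exp (δ / 2 * ‖ξ‖)) := by
      refine (hK ξ).trans ?_
      gcongr
      · exact le_abs_self K
      · exact norm_le_inv_mul_exp (by positivity) ξ
    have h2 : Real.exp (-2 * Real.pi * dot3 y ξ + δ * ‖ξ‖)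
        = Real.exp (-2 * Real.pi * dot3 y ξ + δ / 2 * ‖ξ‖) * Real.exp (δ / 2 * ‖ξ‖) := by
      rw [← Real.exp_add]; congr 1; ring
    rw [h2]
    calc _ ≤ Real.exp (-2 * Real.pi * dot3 y ξ + δ / 2 * ‖ξ‖) *
        (|K| * (1 / (δ / 2) * Real.exp (δ / 2 * ‖ξ‖)) * ‖f ξ‖) := by gcongr
      _ = _ := by ring

theorem integrable_cexp_mul (hf : IsLaplaceAdmissible f) {z : C3} (hz : z ∈ tubeDomain) :
    Integrable (fun ξ => cexp (2 * Real.pi * I * cdot3 z ξ) * f ξ) := by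
  obtain ⟨δ, hδ, h⟩ := hf.integrable _ hz
  have := hf.aestronglyMeasurable
  refine h.mono' (by fun_prop) (Eventually.of_forall fun ξ => ?_)
  rw [norm_mul, norm_cexp_cdot3]
  gcongr
  simp only [le_add_iff_nonneg_right]
  positivity

theorem hasFDerivAt (hf : IsLaplaceAdmissible f) {z : C3} (hz : z ∈ tubeDomain) :
    HasFDerivAt (fourierLaplace f)
      (∫ ξ, (f ξ * cexp (2 * Real.pi * I * cdot3 z ξ)) • ((2 * Real.pi * I : ℂ) • cdot3CLM ξ)) z ∧
    Integrable (fun ξ => (f ξ * cexp (2 * Real.pi * I * cdot3 z ξ)) •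
      ((2 * Real.pi * I : ℂ) • cdot3CLM ξ)) := by
  obtain ⟨δ, hδ, h⟩ := hf.integrable _ hz
  have hfm := hf.aestronglyMeasurable
  have hF'm : AEStronglyMeasurable (fun ξ => (f ξ * cexp (2 * Real.pi * I * cdot3 z ξ)) •
      ((2 * Real.pi * I : ℂ) • cdot3CLM ξ)) := by
    have := continuous_cdot3CLM.aestronglyMeasurable (μ := (volume : Measure R3))
    fun_prop
  -- Moving `z` by less than `r` changes the exponent by at most `2π · 3r‖ξ‖ = (δ/2)‖ξ‖`. The
  -- remaining `δ/2` pays for the linear factor produced by differentiation.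
  set r := δ / 2 / (6 * Real.pi) with hr
  have hr0 : 0 < r := by positivity
  have hbound : ∀ ξ : R3, ∀ w ∈ Metric.ball z r,
      ‖(f ξ * cexp (2 * Real.pi * I * cdot3 w ξ)) • ((2 * Real.pi * I : ℂ) • cdot3CLM ξ)‖
      ≤ 6 * Real.pi * (1 / (δ / 2)) *
        (Real.exp (-2 * Real.pi * dot3 (imPart z) ξ + δ * ‖ξ‖) * ‖f ξ‖) := by
    intro ξ w hw
    rw [mem_ball_iff_norm] at hw
    have h1 : ‖cexp (2 * Real.pi * I * cdot3 w ξ)‖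
        ≤ Real.exp (-2 * Real.pi * dot3 (imPart z) ξ + δ / 2 * ‖ξ‖) := by
      rw [norm_cexp_cdot3]
      refine Real.exp_le_exp.2 ?_
      have h2 : |(cdot3 (w - z) ξ).im| ≤ 3 * ‖ξ‖ * r :=
        (abs_im_le_norm _).trans ((norm_cdot3_le _ _).trans (by gcongr))
      have h3 : (cdot3 (w - z) ξ).im = dot3 (imPart w) ξ - dot3 (imPart z) ξ := by
        rw [im_cdot3]; simp [dot3, imPart]; ring
      rw [h3] at h2
      have h4 := (abs_le.1 h2).1
      have h5 : 2 * Real.pi * (3 * ‖ξ‖ * r) = δ / 2 * ‖ξ‖ := by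
        rw [hr]; field_simp; ring
      nlinarith [Real.pi_pos]
    have h2 : Real.exp (-2 * Real.pi * dot3 (imPart z) ξ + δ * ‖ξ‖)
        = Real.exp (-2 * Real.pi * dot3 (imPart z) ξ + δ / 2 * ‖ξ‖) * Real.exp (δ / 2 * ‖ξ‖) := by
      rw [← Real.exp_add]; congr 1; ring
    have h3 : ‖(2 * Real.pi * I : ℂ)‖ = 2 * Real.pi := by
      simp [abs_of_pos Real.pi_pos]
    rw [h2, norm_smul, norm_smul, norm_mul, h3]
    calc _ ≤ ‖f ξ‖ * Real.exp (-2 * Real.pi * dot3 (imPart z) ξ + δ / 2 * ‖ξ‖)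
          * (2 * Real.pi * (3 * (1 / (δ / 2) * Real.exp (δ / 2 * ‖ξ‖)))) := by
          gcongr
          refine (norm_cdot3CLM_le ξ).trans ?_
          gcongr
          exact norm_le_inv_mul_exp (by positivity) ξ
      _ = _ := by ring
  refine ⟨hasFDerivAt_integral_of_dominated_of_fderiv_le (Metric.ball_mem_nhds z hr0)
    (F := fun z ξ => cexp (2 * Real.pi * I * cdot3 z ξ) * f ξ)
    (F' := fun z ξ => (f ξ * cexp (2 * Real.pi * I * cdot3 z ξ)) •
      ((2 * Real.pi * I : ℂ) • cdot3CLM ξ)) (Eventually.of_forall fun w => by fun_prop)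
    (hf.integrable_cexp_mul hz) hF'm (Eventually.of_forall hbound) (h.const_mul _)
    (Eventually.of_forall fun ξ w _ => ?_), (h.const_mul _).mono' hF'm
      (Eventually.of_forall fun ξ => hbound ξ z (Metric.mem_ball_self hr0))⟩
  have h1 : HasFDerivAt (fun w => cexp (2 * Real.pi * I * cdot3 w ξ))
      (cexp (2 * Real.pi * I * cdot3 w ξ) • ((2 * Real.pi * I : ℂ) • cdot3CLM ξ)) w :=
    ((cdot3CLM ξ).hasFDerivAt.const_mul (2 * Real.pi * I : ℂ)).cexp
  have h2 := h1.mul_const (f ξ)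
  rwa [smul_smul] at h2

theorem differentiableOn (hf : IsLaplaceAdmissible f) :
    DifferentiableOn ℂ (fourierLaplace f) tubeDomain :=
  fun _ hz => (hf.hasFDerivAt hz).1.differentiableAt.differentiableWithinAt

/-- Only agreement on the open tube is assumed: a derivative there sees just the germ of `F`, and
this form can be iterated although nothing is known outside the tube. -/
theorem lineDeriv_eq (hf : IsLaplaceAdmissible f) {F : C3 → ℂ}
    (hF : EqOn F (fourierLaplace f) tubeDomain) {z : C3} (hz : z ∈ tubeDomain) (v : C3) :
    lineDeriv ℝ F z v
      = fourierLaplace (fun ξ => 2 * Real.pi * I * cdot3 v ξ * f ξ) z := by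
  have h0 : F =ᶠ[𝓝 z] fourierLaplace f := hF.eventuallyEq_of_mem (isOpen_tubeDomain.mem_nhds hz)
  obtain ⟨h1, h2⟩ := hf.hasFDerivAt hz
  rw [h0.lineDeriv_eq, ((h1.restrictScalars ℝ).hasLineDerivAt v).lineDeriv]
  rw [ContinuousLinearMap.coe_restrictScalars', ContinuousLinearMap.integral_apply h2]
  refine integral_congr_ae (Eventually.of_forall fun ξ => ?_)
  simp
  ring

/-- Each first-order operator multiplies the density by a linear form: `4π ξ₁`, `4π ξ₂` and `2π ξ₃`
respectively. Hence the symbol `16π² ξ₁ ξ₂ - 4π² ξ₃²`. Admissibility is carried along so that the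
step can be iterated. -/
theorem eqOn_box (hf : IsLaplaceAdmissible f) {F : C3 → ℂ}
    (hF : EqOn F (fourierLaplace f) tubeDomain) :
    EqOn (box F) (fourierLaplace (fun ξ => boxSymbol ξ * f ξ)) tubeDomain ∧
      IsLaplaceAdmissible (fun ξ => boxSymbol ξ * f ξ) := by
  have aux : ∀ {g : R3 → ℂ} {G : C3 → ℂ} (c : ℂ) (v : C3), IsLaplaceAdmissible g →
      EqOn G (fourierLaplace g) tubeDomain →
      EqOn (fun z => c * lineDeriv ℝ G z v)
        (fourierLaplace (fun ξ => c * (2 * Real.pi * I) * cdot3 v ξ * g ξ)) tubeDomain ∧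
      IsLaplaceAdmissible (fun ξ => c * (2 * Real.pi * I) * cdot3 v ξ * g ξ) := by
    intro g G c v hg hG
    refine ⟨fun z hz => ?_, hg.mul_of_norm_le (K := ‖c * (2 * Real.pi * I)‖ * (3 * ‖v‖))
      (by fun_prop) fun ξ => ?_⟩
    · simp only [hg.lineDeriv_eq hG hz, ← fourierLaplace_const_mul]
      congr 1
      funext ξ
      ring
    · rw [norm_mul]
      exact (mul_le_mul_of_nonneg_left (norm_cdot3_le v ξ) (norm_nonneg _)).trans_eq (by ring)
  obtain ⟨a1, a2⟩ := aux (2 / I) ((0, 1), 0) hf hF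
  obtain ⟨b1, b2⟩ := aux (2 / I) ((1, 0), 0) a2 a1
  obtain ⟨c1, c2⟩ := aux (1 / I) ((0, 0), 1) hf hF
  obtain ⟨d1, d2⟩ := aux (1 / I) ((0, 0), 1) c2 c1
  have hsym : ∀ ξ : R3, (boxSymbol ξ : ℂ) * f ξ =
      2 / I * (2 * Real.pi * I) * cdot3 ((1, 0), 0) ξ *
        (2 / I * (2 * Real.pi * I) * cdot3 ((0, 1), 0) ξ * f ξ)
      - 1 / I * (2 * Real.pi * I) * cdot3 ((0, 0), 1) ξ *
        (1 / I * (2 * Real.pi * I) * cdot3 ((0, 0), 1) ξ * f ξ) := by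
    intro ξ
    simp only [boxSymbol, cdot3]
    push_cast
    field_simp
    ring
  simp only [hsym]
  refine ⟨fun z hz => ?_, b2.aestronglyMeasurable.sub d2.aestronglyMeasurable, fun y hy => ?_⟩
  · have e : box F z = opD1 (opD2 F) z - opD3 (opD3 F) z := rfl
    rw [e, show opD1 (opD2 F) z = _ from b1 hz, show opD3 (opD3 F) z = _ from d1 hz]
    simp only [fourierLaplace]
    rw [← integral_sub (b2.integrable_cexp_mul hz) (d2.integrable_cexp_mul hz)]
    congr 1
    funext ξ
    ring
  · obtain ⟨δ, hδ, h⟩ := b2.integrable y hy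
    obtain ⟨δ', hδ', h'⟩ := d2.integrable y hy
    refine ⟨min δ δ', lt_min hδ hδ', (h.add h').mono' ?_ (Eventually.of_forall fun ξ => ?_)⟩
    · have := (b2.aestronglyMeasurable.sub d2.aestronglyMeasurable).norm
      refine AEStronglyMeasurable.mul (by fun_prop) this
    · rw [Real.norm_of_nonneg (by positivity), Pi.add_apply]
      refine (mul_le_mul_of_nonneg_left (norm_sub_le _ _) (Real.exp_pos _).le).trans ?_
      rw [mul_add]
      gcongr
      · exact min_le_left _ _
      · exact min_le_right _ _

theorem eqOn_box_iterate (hf : IsLaplaceAdmissible f) {F : C3 → ℂ}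
    (hF : EqOn F (fourierLaplace f) tubeDomain) (m : ℕ) :
    EqOn (box^[m] F) (fourierLaplace (fun ξ => (boxSymbol ξ : ℂ) ^ m * f ξ)) tubeDomain ∧
      IsLaplaceAdmissible (fun ξ => (boxSymbol ξ : ℂ) ^ m * f ξ) := by
  induction m with
  | zero => simpa using ⟨hF, hf⟩
  | succ m ih =>
    have := ih.2.eqOn_box ih.1
    simpa only [Function.iterate_succ_apply', pow_succ', mul_assoc] using this

end IsLaplaceAdmissible

end FourierLaplace

/-! ### Cone geometry and Paley–Wiener for the Hardy space. -/

section SphericalCone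

open Set Filter Topology

/-- The closed cone dual to `sphericalCone` for the standard scalar product. -/
def dualCone : Set R3 := {ξ | 0 ≤ ξ.1.1 ∧ 0 ≤ ξ.1.2 ∧ ξ.2 ^ 2 ≤ 4 * ξ.1.1 * ξ.1.2}

theorem snd_pos_of_mem_sphericalCone {y : R3} (hy : y ∈ sphericalCone) : 0 < y.1.2 := by
  obtain ⟨h1, h2⟩ := hy
  simp only [coneDet] at h1
  by_contra! h
  nlinarith [sq_nonneg y.2, mul_nonneg h2.le (neg_nonneg.2 h)]

theorem convex_sphericalCone : Convex ℝ sphericalCone := by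
  intro y hy y' hy' a b ha hb hab
  have p2 := snd_pos_of_mem_sphericalCone hy
  have p2' := snd_pos_of_mem_sphericalCone hy'
  obtain ⟨h1, p1⟩ := hy
  obtain ⟨h1', p1'⟩ := hy'
  simp only [coneDet] at h1 h1'
  -- The mixed term of `Δ(a y + b y')` is nonnegative: bound `(y₃ y₃')²` by `y₁ y₂ y₁' y₂'` and use
  -- the arithmetic–geometric mean inequality.
  have key : 2 * (y.2 * y'.2) ≤ y.1.1 * y'.1.2 + y'.1.1 * y.1.2 := by
    refine le_of_sq_le_sq ?_ (by positivity)
    have : (y.2 * y'.2) ^ 2 ≤ (y.1.1 * y.1.2) * (y'.1.1 * y'.1.2) := by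
      rw [mul_pow]
      exact mul_le_mul (by linarith) (by linarith) (sq_nonneg _) (by positivity)
    nlinarith [sq_nonneg (y.1.1 * y'.1.2 - y'.1.1 * y.1.2)]
  have hab' : 0 < a ∨ 0 < b := by
    by_contra! h
    linarith
  simp only [sphericalCone, coneDet, mem_ofPred_eq, Prod.fst_add, Prod.snd_add, Prod.smul_fst,
    Prod.smul_snd, smul_eq_mul]
  have e : (a * y.1.1 + b * y'.1.1) * (a * y.1.2 + b * y'.1.2) - (a * y.2 + b * y'.2) ^ 2
      = a ^ 2 * (y.1.1 * y.1.2 - y.2 ^ 2) + b ^ 2 * (y'.1.1 * y'.1.2 - y'.2 ^ 2)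
        + a * b * (y.1.1 * y'.1.2 + y'.1.1 * y.1.2 - 2 * (y.2 * y'.2)) := by ring
  have k := mul_nonneg (mul_nonneg ha hb) (sub_nonneg.2 key)
  rw [e]
  rcases hab' with h | h
  · constructor <;> positivity
  · constructor <;> positivity

/-- With `c = Δ(y) / (y₁ + y₂)` one has `(y₁ - c)(y₂ - c) = y₃² + c²`, so `y - c (1, 1, 0)` is still
in the cone and pairs nonnegatively with `ξ`. The subtracted part contributes `c (ξ₁ + ξ₂) ≥ c ‖ξ‖`,
as `|ξ₃| ≤ ξ₁ + ξ₂` on the dual cone. -/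
theorem exists_mul_norm_le_dot3 {y : R3} (hy : y ∈ sphericalCone) :
    ∃ c > 0, ∀ ξ ∈ dualCone, c * ‖ξ‖ ≤ dot3 y ξ := by
  have p2 := snd_pos_of_mem_sphericalCone hy
  obtain ⟨h1, p1⟩ := hy
  simp only [coneDet] at h1
  set c := (y.1.1 * y.1.2 - y.2 ^ 2) / (y.1.1 + y.1.2) with hc
  have hc0 : 0 < c := by positivity
  have hcm : c * (y.1.1 + y.1.2) = y.1.1 * y.1.2 - y.2 ^ 2 := by rw [hc]; field_simp
  have hc1 : c < y.1.1 := by nlinarith [sq_nonneg y.2, sq_nonneg y.1.1]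
  have hc2 : c < y.1.2 := by nlinarith [sq_nonneg y.2, sq_nonneg y.1.2]
  refine ⟨c, hc0, fun ξ ⟨q1, q2, q3⟩ => ?_⟩
  have hn : ‖ξ‖ ≤ ξ.1.1 + ξ.1.2 := by
    rw [Prod.norm_def, Prod.norm_def, Real.norm_of_nonneg q1, Real.norm_of_nonneg q2,
      Real.norm_eq_abs]
    refine max_le (max_le (by linarith) (by linarith)) (abs_le_of_sq_le_sq ?_ (by linarith))
    nlinarith [sq_nonneg (ξ.1.1 - ξ.1.2)]
  have k1 : y.2 ^ 2 ≤ (y.1.1 - c) * (y.1.2 - c) := by nlinarith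
  have k2 : -(y.2 * ξ.2) ≤ (y.1.1 - c) * ξ.1.1 + (y.1.2 - c) * ξ.1.2 := by
    refine le_of_sq_le_sq ?_ (by
      have := sub_pos.2 hc1
      have := sub_pos.2 hc2
      positivity)
    have : (y.2 * ξ.2) ^ 2 ≤ ((y.1.1 - c) * (y.1.2 - c)) * (4 * ξ.1.1 * ξ.1.2) := by
      rw [mul_pow]
      exact mul_le_mul k1 q3 (sq_nonneg _) ((sq_nonneg _).trans k1)
    nlinarith [sq_nonneg ((y.1.1 - c) * ξ.1.1 - (y.1.2 - c) * ξ.1.2)]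
  simp only [dot3]
  nlinarith

/-- Testing near the boundary points `(1, t², t)` gives a quadratic polynomial in `t` that is
nonnegative everywhere, and its discriminant is the required inequality. The shift by `ε` keeps the
test points in the open cone. -/
theorem mem_dualCone_of_forall {ξ : R3} (h : ∀ y ∈ sphericalCone, 0 ≤ dot3 y ξ) :
    ξ ∈ dualCone := by
  have lim : ∀ {a b : ℝ}, (∀ ε > 0, 0 ≤ a + ε * b) → 0 ≤ a := by
    intro a b hab
    have h1 : Tendsto (fun ε : ℝ => a + ε * b) (𝓝[>] 0) (𝓝 (a + 0 * b)) :=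
      (Continuous.tendsto (by fun_prop) 0).mono_left nhdsWithin_le_nhds
    rw [zero_mul, add_zero] at h1
    exact ge_of_tendsto h1 (by filter_upwards [self_mem_nhdsWithin] with ε hε using hab ε hε)
  have hq : ∀ t : ℝ, 0 ≤ ξ.1.2 * (t * t) + ξ.2 * t + ξ.1.1 := fun t =>
    lim (b := ξ.1.2) fun ε hε => by
      have := h ((1, t * t + ε), t) ⟨by simp [coneDet, sq, hε], by simp⟩
      simp only [dot3] at this
      linarith
  have hd := discrim_le_zero hq
  refine ⟨by simpa using hq 0, lim (b := ξ.1.1) fun ε hε => ?_, ?_⟩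
  · have := h ((ε, 1), 0) ⟨by simp [coneDet, hε], by simpa using hε⟩
    simp only [dot3] at this
    linarith
  · rw [discrim] at hd
    linarith

theorem isAddHaarMeasure_R3 : (volume : Measure R3).IsAddHaarMeasure :=
  Measure.prod.instIsAddHaarMeasure _ _

/-- On the dual cone `2π⟨y, ξ⟩ ≥ 2c‖ξ‖`, so a slack of `c` still leaves `e^{-c‖ξ‖}`; its product
with `|f|` is dominated by the sum of the squares. -/
theorem isLaplaceAdmissible_of_lintegral_lt_top {f : R3 → ℂ} (hf : AEStronglyMeasurable f)
    (h2 : ∫⁻ ξ, ‖f ξ‖ₑ ^ 2 < ∞) (hs : ∀ᵐ ξ, f ξ ≠ 0 → ξ ∈ dualCone) : IsLaplaceAdmissible f where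
  aestronglyMeasurable := hf
  integrable y hy := by
    obtain ⟨c, hc, h⟩ := exists_mul_norm_le_dot3 hy
    refine ⟨c, hc, ?_⟩
    have := isAddHaarMeasure_R3
    have h1 := integrable_exp_neg_mul_norm (volume : Measure R3) (a := 2 * c) (by positivity)
    have h3 := (memLp_two_iff_integrable_sq_norm hf).1 ((memLp_two_iff_lintegral hf).2 h2)
    refine (h1.add h3).mono' (by have := hf.norm; fun_prop) ?_
    filter_upwards [hs] with ξ hξ
    by_cases h0 : f ξ = 0
    · simp [h0]
      positivity
    · have h4 := h ξ (hξ h0)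
      rw [Real.norm_of_nonneg (by positivity), Pi.add_apply]
      have h5 : Real.exp (-2 * Real.pi * dot3 y ξ + c * ‖ξ‖) ≤ Real.exp (- c * ‖ξ‖) := by
        refine Real.exp_le_exp.2 ?_
        nlinarith [Real.pi_gt_three, (mul_nonneg hc.le (norm_nonneg ξ)).trans h4]
      have h6 : Real.exp (-(2 * c) * ‖ξ‖) = Real.exp (- c * ‖ξ‖) ^ 2 := by
        rw [← Real.exp_nat_mul]; congr 1; push_cast; ring
      rw [h6]
      nlinarith [sq_nonneg (Real.exp (- c * ‖ξ‖) - ‖f ξ‖), norm_nonneg (f ξ), sq_nonneg ‖f ξ‖,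
        sq_nonneg (Real.exp (- c * ‖ξ‖)), mul_le_mul_of_nonneg_right h5 (norm_nonneg (f ξ))]

@[fun_prop]
theorem continuous_tubePoint {X : Type*} [TopologicalSpace X] {f g : X → R3} (hf : Continuous f)
    (hg : Continuous g) : Continuous (fun a => tubePoint (f a) (g a)) := by
  unfold tubePoint
  fun_prop

@[simp] theorem imPart_tubePoint (x y : R3) : imPart (tubePoint x y) = y := by
  simp [imPart, tubePoint]

theorem tubePoint_mem {x y : R3} (hy : y ∈ sphericalCone) : tubePoint x y ∈ tubeDomain := by
  simpa [tubeDomain] using hy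

theorem exists_eq_tubePoint (z : C3) : ∃ x, z = tubePoint x (imPart z) :=
  ⟨((z.1.1.re, z.1.2.re), z.2.re), by simp [tubePoint, imPart]⟩

theorem hardyNorm_sq (F : C3 → ℂ) :
    hardyNorm F ^ 2 = ⨆ y ∈ sphericalCone, ∫⁻ x : R3, ‖F (tubePoint x y)‖ₑ ^ 2 := by
  rw [hardyNorm, ← ENNReal.rpow_natCast, ← ENNReal.rpow_mul]
  norm_num

theorem lintegral_le_hardyNorm_sq (F : C3 → ℂ) {y : R3} (hy : y ∈ sphericalCone) :
    ∫⁻ x : R3, ‖F (tubePoint x y)‖ₑ ^ 2 ≤ hardyNorm F ^ 2 := by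
  rw [hardyNorm_sq]
  exact le_iSup₂ (f := fun y _ => ∫⁻ x : R3, ‖F (tubePoint x y)‖ₑ ^ 2) y hy

theorem isSquareIntegrableOnTube_of_memHardy {F : C3 → ℂ} (hF : MemHardy F) :
    IsSquareIntegrableOnTube sphericalCone (fun x y => F (tubePoint x y)) where
  continuousOn := hF.1.continuousOn.comp (f := fun p : R3 × R3 => tubePoint p.1 p.2)
    (by fun_prop) fun p hp => tubePoint_mem hp.2
  differentiableOn x y v hy hv := by
    refine hF.1.comp (f := fun ζ : ℂ => tubePoint (x + ζ.re • v) (y + ζ.im • v))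
      (Differentiable.differentiableOn ?_) fun ζ hζ => tubePoint_mem ?_
    · have : (fun ζ : ℂ => tubePoint (x + ζ.re • v) (y + ζ.im • v)) = fun ζ : ℂ =>
          tubePoint x y + ζ • tubePoint v 0 := by
        funext ζ
        have hζ : (ζ : ℂ) = ζ.re + ζ.im * I := (re_add_im ζ).symm
        simp only [tubePoint]
        ext <;> simp <;> conv_rhs => rw [hζ]
        all_goals ring
      rw [this]
      fun_prop
    · have := convex_sphericalCone.add_smul_sub_mem hy hv hζ.2
      simpa using this
  lintegral_le y v hy hv := by
    refine ⟨hardyNorm F ^ 2, by have := hF.2; finiteness, fun t ht => ?_⟩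
    refine lintegral_le_hardyNorm_sq F ?_
    have := convex_sphericalCone.add_smul_sub_mem hy hv ht
    simpa using this

theorem dot3_smul (t : ℝ) (y ξ : R3) : dot3 (t • y) ξ = t * dot3 y ξ := by
  simp [dot3]; ring

theorem smul_mem_sphericalCone {t : ℝ} (ht : 0 < t) {y : R3} (hy : y ∈ sphericalCone) :
    t • y ∈ sphericalCone := by
  obtain ⟨h1, h2⟩ := hy
  refine ⟨?_, by simpa using mul_pos ht h2⟩
  have : coneDet (t • y) = t ^ 2 * coneDet y := by simp [coneDet]; ring
  rw [this]
  positivity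

/-- A function whose exponentially weighted `L²` norms are bounded on the cone is supported in the
dual cone. -/
theorem ae_mem_dualCone {f : R3 → ℂ} (hf : Measurable f) {C : ℝ≥0∞} (hC : C < ∞)
    (h : ∀ y ∈ sphericalCone,
      ∫⁻ ξ, ‖f ξ‖ₑ ^ 2 * ENNReal.ofReal (Real.exp (-4 * Real.pi * dot3 y ξ)) ≤ C) :
    ∀ᵐ ξ, f ξ ≠ 0 → ξ ∈ dualCone := by
  have hm : ∀ y, Measurable (fun ξ =>
      ‖f ξ‖ₑ ^ 2 * ENNReal.ofReal (Real.exp (-4 * Real.pi * dot3 y ξ))) := by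
    intro y; fun_prop
  have step : ∀ y ∈ sphericalCone, ∀ᵐ ξ, f ξ ≠ 0 → 0 ≤ dot3 y ξ := by
    intro y hy
    -- Fatou along the ray `(n + 1) y`: where `⟨y, ξ⟩ < 0` the weights tend to infinity while the
    -- integrals stay below `C`, so `f` vanishes almost everywhere there.
    have hle := lintegral_liminf_le (μ := (volume : Measure R3)) (u := atTop)
      (fun n : ℕ => hm (((n : ℝ) + 1) • y))
    have hlt := hle.trans_lt ((liminf_le_of_le (a := C) (by isBoundedDefault) fun b hb => by
      obtain ⟨n, hn⟩ := hb.exists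
      exact hn.trans (h _ (smul_mem_sphericalCone (by positivity) hy))).trans_lt hC)
    filter_upwards [ae_lt_top (Measurable.liminf fun n : ℕ => hm (((n : ℝ) + 1) • y)) hlt.ne] with ξ hξ h0
    by_contra! hneg
    have h1 : Tendsto (fun n : ℕ => ‖f ξ‖ₑ ^ 2 * ENNReal.ofReal
        (Real.exp (-4 * Real.pi * dot3 (((n : ℝ) + 1) • y) ξ))) atTop (𝓝 ∞) := by
      have h2 : Tendsto (fun n : ℕ => ENNReal.ofReal
        (Real.exp (-4 * Real.pi * dot3 (((n : ℝ) + 1) • y) ξ))) atTop (𝓝 ∞) := by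
        refine ENNReal.tendsto_ofReal_atTop.comp (Real.tendsto_exp_atTop.comp ?_)
        have h3 : Tendsto (fun n : ℕ => ((n : ℝ) + 1) * (-4 * Real.pi * dot3 y ξ)) atTop atTop :=
          (tendsto_atTop_add_const_right _ 1 tendsto_natCast_atTop_atTop).atTop_mul_const
            (by nlinarith [Real.pi_pos])
        refine h3.congr fun n => ?_
        rw [dot3_smul]
        ring
      have h4 := ENNReal.Tendsto.const_mul (a := ‖f ξ‖ₑ ^ 2) h2 (Or.inl (by simp))
      rwa [ENNReal.mul_top (by simpa using h0)] at h4
    rw [h1.liminf_eq] at hξ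
    exact lt_irrefl _ hξ
  -- A countable dense set of `y` makes the exceptional null set independent of `y`; continuity of
  -- the pairing recovers the whole cone.
  obtain ⟨D, hDc, hD⟩ := TopologicalSpace.exists_countable_dense R3
  have hall : ∀ᵐ ξ, ∀ y ∈ D ∩ sphericalCone, f ξ ≠ 0 → 0 ≤ dot3 y ξ :=
    (ae_ball_iff (hDc.mono inter_subset_left)).2 fun y hy => step y hy.2
  filter_upwards [hall] with ξ hξ h0
  refine mem_dualCone_of_forall fun y hy => ?_
  have hcl : IsClosed {y | 0 ≤ dot3 y ξ} := by
    unfold dot3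
    exact isClosed_le (by fun_prop) (by fun_prop)
  have := hD.open_subset_closure_inter isOpen_sphericalCone hy
  rw [inter_comm] at this
  exact closure_minimal (fun y hy => hξ y hy h0) hcl this

/-- The Paley--Wiener theorem for the Hardy space of the tube domain. -/
theorem MemHardy.exists_fourierLaplace {F : C3 → ℂ} (hF : MemHardy F) :
    ∃ f : R3 → ℂ, Measurable f ∧ (∀ᵐ ξ, f ξ ≠ 0 → ξ ∈ dualCone) ∧
      ∫⁻ ξ, ‖f ξ‖ₑ ^ 2 ≤ hardyNorm F ^ 2 ∧ EqOn F (fourierLaplace f) tubeDomain := by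
  have hC : hardyNorm F ^ 2 < ∞ := by have := hF.2; finiteness
  have hy₀ : (((1, 1), 0) : R3) ∈ sphericalCone := by simp [sphericalCone, coneDet]
  obtain ⟨f, hf, h⟩ := (isSquareIntegrableOnTube_of_memHardy hF).exists_fourier_repr_of_equiv
    measurePreserving_euclideanThree convex_sphericalCone ⟨_, hy₀⟩
  simp only [inner_euclideanThree] at h
  have hle : ∀ y ∈ sphericalCone,
      ∫⁻ ξ, ‖f ξ‖ₑ ^ 2 * ENNReal.ofReal (Real.exp (-4 * Real.pi * dot3 y ξ)) ≤ hardyNorm F ^ 2 :=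
    fun y hy => (h y hy).1.trans_le (lintegral_le_hardyNorm_sq F hy)
  have hs := ae_mem_dualCone hf hC hle
  -- Fatou again, now with `y` tending to the vertex of the cone along `(1, 1, 0)`.
  have hL2 : ∫⁻ ξ, ‖f ξ‖ₑ ^ 2 ≤ hardyNorm F ^ 2 := by
    have hlim : ∀ ξ, Tendsto (fun n : ℕ => ‖f ξ‖ₑ ^ 2 * ENNReal.ofReal
        (Real.exp (-4 * Real.pi * dot3 ((1 / ((n : ℝ) + 1)) • ((1, 1), 0)) ξ))) atTop
        (𝓝 (‖f ξ‖ₑ ^ 2)) := by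
      intro ξ
      have h1 : Tendsto (fun n : ℕ => Real.exp (-4 * Real.pi *
          dot3 ((1 / ((n : ℝ) + 1)) • ((1, 1), 0)) ξ)) atTop (𝓝 1) := by
        simp only [dot3_smul]
        have h2 : Continuous (fun t : ℝ =>
          Real.exp (-4 * Real.pi * (t * dot3 ((1, 1), 0) ξ))) := by fun_prop
        simpa [Function.comp_def] using (h2.tendsto 0).comp tendsto_one_div_add_atTop_nhds_zero_nat
      simpa using ENNReal.Tendsto.const_mul (a := ‖f ξ‖ₑ ^ 2) (ENNReal.tendsto_ofReal h1)
        (Or.inl (by simp))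
    calc ∫⁻ ξ, ‖f ξ‖ₑ ^ 2 = ∫⁻ ξ, liminf (fun n : ℕ => ‖f ξ‖ₑ ^ 2 * ENNReal.ofReal
        (Real.exp (-4 * Real.pi * dot3 ((1 / ((n : ℝ) + 1)) • ((1, 1), 0)) ξ))) atTop :=
          lintegral_congr fun ξ => (hlim ξ).liminf_eq.symm
      _ ≤ _ := lintegral_liminf_le fun n => by fun_prop
      _ ≤ _ := liminf_le_of_le (by isBoundedDefault) fun b hb => by
          obtain ⟨n, hn⟩ := hb.exists
          exact hn.trans (hle _ (smul_mem_sphericalCone (by positivity) hy₀))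
  refine ⟨f, hf, hs, hL2, fun z hz => ?_⟩
  have hadm := isLaplaceAdmissible_of_lintegral_lt_top hf.aestronglyMeasurable
    (hL2.trans_lt hC) hs
  obtain ⟨x, hx⟩ := exists_eq_tubePoint z
  have hi : Integrable (fun ξ => (Real.exp (-2 * Real.pi * dot3 (imPart z) ξ) : ℂ) * f ξ) := by
    refine (hadm.integrable_cexp_mul hz).mono (by fun_prop) (Eventually.of_forall fun ξ => ?_)
    rw [norm_mul, norm_mul, norm_cexp_cdot3, norm_real, Real.norm_of_nonneg (Real.exp_pos _).le]
  have := (h _ hz).2 hi x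
  simp only [← cdot3_tubePoint, ← hx] at this
  exact this

/-- Plancherel on the fibre over `y`; the damping `e^{-2π⟨y, ξ⟩}` is at most `1` on the dual cone.
-/
theorem lintegral_fourierLaplace_sq_le {f : R3 → ℂ} (hf : IsLaplaceAdmissible f)
    (hs : ∀ᵐ ξ, f ξ ≠ 0 → ξ ∈ dualCone) {y : R3} (hy : y ∈ sphericalCone) :
    ∫⁻ x, ‖fourierLaplace f (tubePoint x y)‖ₑ ^ 2 ≤ ∫⁻ ξ, ‖f ξ‖ₑ ^ 2 := by
  have hfm := hf.aestronglyMeasurable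
  have hi : Integrable (fun ξ => (Real.exp (-2 * Real.pi * dot3 y ξ) : ℂ) * f ξ) := by
    refine (hf.integrable_cexp_mul (tubePoint_mem (x := 0) hy)).mono (by fun_prop)
      (Eventually.of_forall fun ξ => ?_)
    rw [norm_mul, norm_mul, norm_cexp_cdot3, norm_real, Real.norm_of_nonneg (Real.exp_pos _).le,
      imPart_tubePoint]
  have h := lintegral_fourierInv_sq_le_of_equiv measurePreserving_euclideanThree hi
  simp only [inner_euclideanThree] at h
  refine (le_of_eq (lintegral_congr fun x => ?_)).trans (h.trans (lintegral_mono_ae ?_))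
  · rw [fourierLaplace]
    congr 3
    funext ξ
    rw [cdot3_tubePoint, ofReal_exp, ← mul_assoc, ← Complex.exp_add]
    congr 2
    push_cast
    linear_combination (2 * Real.pi * (dot3 y ξ : ℂ)) * I_sq
  · filter_upwards [hs] with ξ hξ
    by_cases h0 : f ξ = 0
    · simp [h0]
    · obtain ⟨c, hc, hd⟩ := exists_mul_norm_le_dot3 hy
      have h1 : 0 ≤ dot3 y ξ := (by positivity : 0 ≤ c * ‖ξ‖).trans (hd ξ (hξ h0))
      gcongr
      rw [← ofReal_norm, ← ofReal_norm]
      refine ENNReal.ofReal_le_ofReal ?_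
      rw [norm_mul, norm_real, Real.norm_of_nonneg (Real.exp_pos _).le]
      refine mul_le_of_le_one_left (norm_nonneg _) (Real.exp_le_one_iff.2 ?_)
      nlinarith [mul_nonneg Real.pi_pos.le h1]

theorem memHardy_fourierLaplace {f : R3 → ℂ} (hf : AEStronglyMeasurable f)
    (h2 : ∫⁻ ξ, ‖f ξ‖ₑ ^ 2 < ∞) (hs : ∀ᵐ ξ, f ξ ≠ 0 → ξ ∈ dualCone) :
    MemHardy (fourierLaplace f) ∧ hardyNorm (fourierLaplace f) ^ 2 ≤ ∫⁻ ξ, ‖f ξ‖ₑ ^ 2 := by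
  have hadm := isLaplaceAdmissible_of_lintegral_lt_top hf h2 hs
  have hle : hardyNorm (fourierLaplace f) ^ 2 ≤ ∫⁻ ξ, ‖f ξ‖ₑ ^ 2 := by
    rw [hardyNorm_sq]
    exact iSup₂_le fun y hy => lintegral_fourierLaplace_sq_le hadm hs hy
  refine ⟨⟨hadm.differentiableOn, ?_⟩, hle⟩
  have := hle.trans_lt h2
  rwa [ENNReal.pow_lt_top_iff, or_iff_left two_ne_zero] at this

end SphericalCone

/-! ### Mean value inequalities on discs and polydiscs. -/

section MeanValue

open Set Filter Topology Metric

theorem ContinuousOn.measurable_indicator_of_measurableSet {α β : Type*} [TopologicalSpace α]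
    [MeasurableSpace α] [OpensMeasurableSpace α] [TopologicalSpace β] [MeasurableSpace β]
    [BorelSpace β] [Zero β] {f : α → β} {s : Set α} (hf : ContinuousOn f s)
    (hs : MeasurableSet s) : Measurable (s.indicator f) := by
  classical
  rw [← piecewise_eq_indicator]
  exact hf.measurable_piecewise continuousOn_const hs

/-- The circle mean value property, over `(-π, π)` and in trigonometric form to match the polar
coordinates used for the area version. -/
theorem two_pi_mul_enorm_le {f : ℂ → ℂ} {c : ℂ} {R r : ℝ} (hf : DifferentiableOn ℂ f (ball c R))
    (h0 : 0 < r) (hr : r < R) :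
    ENNReal.ofReal (2 * Real.pi) * ‖f c‖ₑ ≤ ∫⁻ θ in Ioo (-Real.pi) Real.pi,
      ‖f (c + r * (Real.cos θ + Real.sin θ * I))‖ₑ := by
  have hd : DiffContOnCl ℂ f (ball c |r|) := by
    rw [abs_of_pos h0]
    exact (hf.mono (closedBall_subset_ball hr)).diffContOnCl_ball subset_rfl
  have h1 := hd.circleAverage
  rw [Real.circleAverage_eq_integral_add (-Real.pi),
    intervalIntegral.integral_comp_add_right (fun θ => f (circleMap c r θ))] at h1
  have h2 : (∫ θ in (-Real.pi)..Real.pi, f (circleMap c r θ)) = (2 * Real.pi) • f c := by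
    rw [← h1, smul_smul, mul_inv_cancel₀ (by positivity), one_smul]
    congr 1 <;> ring
  calc ENNReal.ofReal (2 * Real.pi) * ‖f c‖ₑ
      = ‖∫ θ in (-Real.pi)..Real.pi, f (circleMap c r θ)‖ₑ := by
        rw [h2, enorm_smul, Real.enorm_of_nonneg (by positivity)]
    _ ≤ ∫⁻ θ in Ioo (-Real.pi) Real.pi, ‖f (circleMap c r θ)‖ₑ := by
        rw [intervalIntegral.integral_of_le (by linarith [Real.pi_pos]), integral_Ioc_eq_integral_Ioo]
        exact enorm_integral_le_lintegral_enorm _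
    _ = _ := by
        refine lintegral_congr fun θ => ?_
        rw [circleMap, exp_mul_I]
        simp

/-- The area mean value inequality for the modulus of a holomorphic function. -/
theorem area_mul_enorm_le {f : ℂ → ℂ} {c : ℂ} {R : ℝ} (hR : 0 < R)
    (hf : DifferentiableOn ℂ f (ball c R)) :
    ENNReal.ofReal (Real.pi * R ^ 2) * ‖f c‖ₑ ≤ ∫⁻ w in ball c R, ‖f w‖ₑ := by
  set h : ℂ → ℝ≥0∞ := (ball c R).indicator (fun w => ‖f w‖ₑ) with hh
  have hm : Measurable h :=
    hf.continuousOn.enorm.measurable_indicator_of_measurableSet measurableSet_ball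
  have h1 : ∫⁻ w in ball c R, ‖f w‖ₑ = ∫⁻ w, h (c + w) := by
    rw [lintegral_add_left_eq_self h c, lintegral_indicator measurableSet_ball]
  rw [h1, ← Complex.lintegral_comp_polarCoord_symm, polarCoord_target, Measure.volume_eq_prod,
    ← Measure.prod_restrict, lintegral_prod _ (by
      have : Measurable fun p : ℝ × ℝ => Complex.polarCoord.symm p := by
        simp only [Complex.polarCoord_symm_apply]
        fun_prop
      simp only [smul_eq_mul]
      fun_prop)]
  have hsub : Ioo 0 R ⊆ Ioi (0 : ℝ) := fun r hr => hr.1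
  refine le_trans ?_ (lintegral_mono_set hsub)
  calc ENNReal.ofReal (Real.pi * R ^ 2) * ‖f c‖ₑ
      = ∫⁻ r in Ioo 0 R, ENNReal.ofReal r * (ENNReal.ofReal (2 * Real.pi) * ‖f c‖ₑ) := by
        rw [lintegral_mul_const _ (by fun_prop), ← mul_assoc]
        congr 1
        rw [← ofReal_integral_eq_lintegral_ofReal, ← ENNReal.ofReal_mul']
        · rw [← integral_Ioc_eq_integral_Ioo, ← intervalIntegral.integral_of_le hR.le, integral_id]
          congr 1; ring
        · positivity
        · exact (continuous_id.integrableOn_Icc (a := 0) (b := R)).mono_set Ioo_subset_Icc_self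
        · filter_upwards [ae_restrict_mem measurableSet_Ioo] with r hr using hr.1.le
    _ ≤ _ := by
        refine setLIntegral_mono' measurableSet_Ioo fun r hr => ?_
        simp only [smul_eq_mul]
        rw [lintegral_const_mul _ (by
          simp only [Complex.polarCoord_symm_apply]
          fun_prop)]
        gcongr
        refine (two_pi_mul_enorm_le hf hr.1 hr.2).trans (le_of_eq ?_)
        refine lintegral_congr fun θ => ?_
        rw [hh, indicator_of_mem, Complex.polarCoord_symm_apply]
        rw [mem_ball, dist_eq_norm, add_sub_cancel_left, Complex.norm_polarCoord_symm]
        simpa [abs_of_pos hr.1] using hr.2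

/-- The square of a holomorphic function is holomorphic, so the first-power inequality applies to
it. -/
theorem area_mul_enorm_sq_le {f : ℂ → ℂ} {c : ℂ} {R : ℝ} (hR : 0 < R)
    (hf : DifferentiableOn ℂ f (ball c R)) :
    ENNReal.ofReal (Real.pi * R ^ 2) * ‖f c‖ₑ ^ 2 ≤ ∫⁻ w in ball c R, ‖f w‖ₑ ^ 2 := by
  have := area_mul_enorm_le hR (hf.pow 2)
  simpa only [Pi.pow_apply, enorm_pow] using this

theorem polydisc_mul_enorm_sq_le {G : ℂ × ℂ → ℂ} {z : ℂ × ℂ} {R : ℝ} (hR : 0 < R)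
    (hG : DifferentiableOn ℂ G (ball z.1 R ×ˢ ball z.2 R)) :
    ENNReal.ofReal (Real.pi * R ^ 2) ^ 2 * ‖G z‖ₑ ^ 2
      ≤ ∫⁻ w in ball z.1 R ×ˢ ball z.2 R, ‖G w‖ₑ ^ 2 := by
  have hm : AEMeasurable (fun w => ‖G w‖ₑ ^ 2)
      ((volume.restrict (ball z.1 R)).prod (volume.restrict (ball z.2 R))) := by
    rw [Measure.prod_restrict]
    exact (hG.continuousOn.aemeasurable (measurableSet_ball.prod measurableSet_ball)).enorm.pow_const 2
  rw [Measure.volume_eq_prod, ← Measure.prod_restrict, lintegral_prod _ hm]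
  calc _ = ENNReal.ofReal (Real.pi * R ^ 2) * (ENNReal.ofReal (Real.pi * R ^ 2) * ‖G z‖ₑ ^ 2) := by
        ring
    _ ≤ ENNReal.ofReal (Real.pi * R ^ 2) * ∫⁻ w in ball z.1 R, ‖G (w, z.2)‖ₑ ^ 2 := by
        gcongr
        exact area_mul_enorm_sq_le (f := fun w => G (w, z.2)) hR
          (hG.comp (by fun_prop) fun w hw => ⟨hw, mem_ball_self hR⟩)
    _ = ∫⁻ w in ball z.1 R, ENNReal.ofReal (Real.pi * R ^ 2) * ‖G (w, z.2)‖ₑ ^ 2 := by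
        rw [lintegral_const_mul' _ _ (by finiteness)]
    _ ≤ _ := by
        refine setLIntegral_mono' measurableSet_ball fun w hw => ?_
        exact area_mul_enorm_sq_le (f := fun u => G (w, u)) hR
          (hG.comp (by fun_prop) fun u hu => ⟨hw, hu⟩)

end MeanValue

/-! ### Fibres of Bergman functions are square integrable. -/

section Bergman

open Set Filter Topology Metric

/-- The point `x + iy` of `ℂ²`. -/
def bitube (x y : ℝ × ℝ) : ℂ × ℂ := ((x.1 : ℂ) + y.1 * I, (x.2 : ℂ) + y.2 * I)

/-- The open first quadrant. -/
def quadrant : Set (ℝ × ℝ) := Ioi 0 ×ˢ Ioi 0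

@[fun_prop]
theorem continuous_bitube {X : Type*} [TopologicalSpace X] {f g : X → ℝ × ℝ} (hf : Continuous f)
    (hg : Continuous g) : Continuous (fun a => bitube (f a) (g a)) := by
  unfold bitube
  fun_prop

theorem bitube_mem_biHalfPlane {x y : ℝ × ℝ} : bitube x y ∈ biHalfPlane ↔ y ∈ quadrant := by
  simp [biHalfPlane, quadrant, bitube]

theorem isOpen_biHalfPlane : IsOpen biHalfPlane := by
  unfold biHalfPlane
  exact (isOpen_lt (by fun_prop) (by fun_prop)).and (isOpen_lt (by fun_prop) (by fun_prop))

theorem measurableSet_biHalfPlane : MeasurableSet biHalfPlane := isOpen_biHalfPlane.measurableSet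

theorem measurableSet_quadrant : MeasurableSet quadrant := measurableSet_Ioi.prod measurableSet_Ioi

theorem lintegral_complex_prod {H : ℂ × ℂ → ℝ≥0∞} (hH : Measurable H) :
    ∫⁻ z, H z = ∫⁻ y, ∫⁻ x, H (bitube x y) := by
  have e : ∀ {K : ℂ → ℝ≥0∞}, Measurable K → ∫⁻ z, K z = ∫⁻ b : ℝ, ∫⁻ a : ℝ, K (a + b * I) := by
    intro K hK
    rw [← Complex.volume_preserving_equiv_real_prod.symm.lintegral_comp hK, Measure.volume_eq_prod,
      lintegral_prod_symm _ (by fun_prop)]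
    refine lintegral_congr fun b => lintegral_congr fun a => ?_
    congr 1
    apply Complex.ext <;> simp
  have h1 : ∀ a b : ℝ, Measurable fun w : ℂ => H (a + b * I, w) := fun a b => by fun_prop
  rw [Measure.volume_eq_prod, lintegral_prod _ hH.aemeasurable, e (by fun_prop),
    Measure.volume_eq_prod, lintegral_prod _ (by fun_prop)]
  refine lintegral_congr fun b => ?_
  simp only [e (h1 _ b)]
  rw [lintegral_lintegral_swap (by fun_prop)]
  refine lintegral_congr fun b' => ?_
  rw [lintegral_prod _ (by fun_prop)]
  rfl

theorem bergmanNorm_sq_eq_setLIntegral (α : ℝ) (G : ℂ × ℂ → ℂ) :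
    bergmanNorm α G ^ 2 = ∫⁻ z in biHalfPlane,
      ‖G z‖ₑ ^ 2 * ENNReal.ofReal (z.1.im ^ α * z.2.im ^ α) := by
  rw [bergmanNorm, ← ENNReal.rpow_natCast, ← ENNReal.rpow_mul]
  norm_num

theorem bergmanNorm_sq {α : ℝ} {G : ℂ × ℂ → ℂ} (hG : ContinuousOn G biHalfPlane) :
    bergmanNorm α G ^ 2 = ∫⁻ y in quadrant, ENNReal.ofReal (y.1 ^ α * y.2 ^ α) *
      ∫⁻ x, ‖G (bitube x y)‖ₑ ^ 2 := by
  have hm : Measurable (biHalfPlane.indicator (fun z => ‖G z‖ₑ)) :=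
    hG.enorm.measurable_indicator_of_measurableSet measurableSet_biHalfPlane
  have h2 : ∀ z, biHalfPlane.indicator (fun z => ‖G z‖ₑ ^ 2 *
      ENNReal.ofReal (z.1.im ^ α * z.2.im ^ α)) z = (biHalfPlane.indicator (fun z => ‖G z‖ₑ) z) ^ 2
        * ENNReal.ofReal (z.1.im ^ α * z.2.im ^ α) := by
    intro z
    by_cases hz : z ∈ biHalfPlane <;> simp [hz]
  rw [bergmanNorm_sq_eq_setLIntegral, ← lintegral_indicator measurableSet_biHalfPlane]
  simp only [h2]
  rw [lintegral_complex_prod (by fun_prop), ← lintegral_indicator measurableSet_quadrant]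
  refine lintegral_congr fun y => ?_
  by_cases hy : y ∈ quadrant
  · rw [indicator_of_mem hy, ← lintegral_const_mul' _ _ (by finiteness)]
    refine lintegral_congr fun x => ?_
    rw [indicator_of_mem (bitube_mem_biHalfPlane.2 hy), mul_comm]
    simp [bitube]
  · rw [indicator_of_notMem hy]
    refine (lintegral_congr fun x => ?_).trans lintegral_zero
    rw [indicator_of_notMem (by rwa [bitube_mem_biHalfPlane])]
    simp

theorem convex_quadrant : Convex ℝ quadrant := (convex_Ioi 0).prod (convex_Ioi 0)

/-- The `L²` norms of the fibres of a holomorphic function are controlled by the integral over a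
neighbouring strip. -/
theorem mul_lintegral_fibre_le {G : ℂ × ℂ → ℂ} (hG : DifferentiableOn ℂ G biHalfPlane)
    {y : ℝ × ℝ} {r : ℝ} (hr : 0 < r) (h1 : r ≤ y.1) (h2 : r ≤ y.2) :
    ENNReal.ofReal (Real.pi * r ^ 2) ^ 2 * ∫⁻ x, ‖G (bitube x y)‖ₑ ^ 2 ≤
      ENNReal.ofReal (2 * r) ^ 2 *
        ∫⁻ w in {w : ℂ × ℂ | |w.1.im - y.1| < r ∧ |w.2.im - y.2| < r}, ‖G w‖ₑ ^ 2 := by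
  set S : Set (ℂ × ℂ) := {w : ℂ × ℂ | |w.1.im - y.1| < r ∧ |w.2.im - y.2| < r} with hS
  have hSo : IsOpen S :=
    (isOpen_lt (by fun_prop) (by fun_prop)).and (isOpen_lt (by fun_prop) (by fun_prop))
  have hSm : MeasurableSet S := hSo.measurableSet
  have hSsub : S ⊆ biHalfPlane := fun w hw =>
    ⟨by linarith [(abs_lt.1 hw.1).1], by linarith [(abs_lt.1 hw.2).1]⟩
  set B : ℂ × ℂ → ℝ≥0∞ := S.indicator (fun w => ‖G w‖ₑ ^ 2) with hB
  have hBm : Measurable B := by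
    have : Measurable (S.indicator (fun w => ‖G w‖ₑ)) :=
      (hG.mono hSsub).continuousOn.enorm.measurable_indicator_of_measurableSet hSm
    have h3 : B = fun w => (S.indicator (fun w => ‖G w‖ₑ) w) ^ 2 := by
      funext w
      by_cases hw : w ∈ S <;> simp [hB, hw]
    rw [h3]
    fun_prop
  -- `T` keeps the real parts within `r` of `x`; integrating its indicator over `x` first gives the
  -- factor `(2r)²` in Fubini.
  set T : Set ((ℝ × ℝ) × (ℂ × ℂ)) := {p | |p.2.1.re - p.1.1| < r ∧ |p.2.2.re - p.1.2| < r} with hT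
  have hTm : MeasurableSet T := IsOpen.measurableSet
    ((isOpen_lt (by fun_prop) (by fun_prop)).and (isOpen_lt (by fun_prop) (by fun_prop)))
  have hpt : ∀ x, ENNReal.ofReal (Real.pi * r ^ 2) ^ 2 * ‖G (bitube x y)‖ₑ ^ 2
      ≤ ∫⁻ w, B w * T.indicator 1 (x, w) := by
    intro x
    have hsub : ∀ w ∈ ball (bitube x y).1 r ×ˢ ball (bitube x y).2 r, w ∈ S ∧ (x, w) ∈ T := by
      rintro w ⟨k1, k2⟩
      rw [mem_ball_iff_norm] at k1 k2
      refine ⟨⟨?_, ?_⟩, ?_, ?_⟩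
      · simpa [bitube] using (abs_im_le_norm _).trans_lt k1
      · simpa [bitube] using (abs_im_le_norm _).trans_lt k2
      · simpa [bitube] using (abs_re_le_norm _).trans_lt k1
      · simpa [bitube] using (abs_re_le_norm _).trans_lt k2
    refine (polydisc_mul_enorm_sq_le hr (hG.mono fun w hw => hSsub (hsub w hw).1)).trans ?_
    rw [← lintegral_indicator (measurableSet_ball.prod measurableSet_ball)]
    refine lintegral_mono fun w => ?_
    by_cases hw : w ∈ ball (bitube x y).1 r ×ˢ ball (bitube x y).2 r
    · rw [indicator_of_mem hw, hB, indicator_of_mem (hsub w hw).1, indicator_of_mem (hsub w hw).2]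
      simp
    · rw [indicator_of_notMem hw]
      exact zero_le
  have hTi : Measurable (fun p : (ℝ × ℝ) × (ℂ × ℂ) => T.indicator (1 : (ℝ × ℝ) × (ℂ × ℂ) → ℝ≥0∞) p) :=
    measurable_one.indicator hTm
  have hvol : ∀ w : ℂ × ℂ, ∫⁻ x, T.indicator (1 : (ℝ × ℝ) × (ℂ × ℂ) → ℝ≥0∞) (x, w) = ENNReal.ofReal (2 * r) ^ 2 := by
    intro w
    have : ∀ x : ℝ × ℝ, T.indicator (1 : (ℝ × ℝ) × (ℂ × ℂ) → ℝ≥0∞) (x, w)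
        = (ball w.1.re r ×ˢ ball w.2.re r).indicator 1 x := by
      intro x
      simp only [indicator, hT, mem_ofPred_eq, mem_prod, mem_ball, Real.dist_eq, Pi.one_apply,
        abs_sub_comm]
    simp only [this]
    rw [lintegral_indicator_one (measurableSet_ball.prod measurableSet_ball),
      Measure.volume_eq_prod, Measure.prod_prod, Real.volume_ball, Real.volume_ball, sq]
  calc _ = ∫⁻ x, ENNReal.ofReal (Real.pi * r ^ 2) ^ 2 * ‖G (bitube x y)‖ₑ ^ 2 := by
        rw [lintegral_const_mul' _ _ (by finiteness)]
    _ ≤ ∫⁻ x, ∫⁻ w, B w * T.indicator 1 (x, w) := lintegral_mono hpt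
    _ = ∫⁻ w, ∫⁻ x, B w * T.indicator 1 (x, w) := lintegral_lintegral_swap (by fun_prop)
    _ = ∫⁻ w, B w * ENNReal.ofReal (2 * r) ^ 2 := by
        refine lintegral_congr fun w => ?_
        rw [lintegral_const_mul _ (by fun_prop), hvol]
    _ = _ := by
        rw [lintegral_mul_const _ hBm, mul_comm, hB, lintegral_indicator hSm]

/-- The Bergman norm controls fibres only on average over `y`; the mean value inequality turns this
into a uniform bound on segments. With `a` and `b` the extreme coordinates of the endpoints, strips
of half-width `a / 2` stay in `[a/2, b + a/2]`, where the weight is bounded below. -/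
theorem isSquareIntegrableOnTube_of_memBergman {α : ℝ} {G : ℂ × ℂ → ℂ} (hG : MemBergman α G) :
    IsSquareIntegrableOnTube quadrant (fun x y => G (bitube x y)) where
  continuousOn := hG.1.continuousOn.comp (f := fun p : (ℝ × ℝ) × (ℝ × ℝ) => bitube p.1 p.2)
    (by fun_prop) fun p hp => bitube_mem_biHalfPlane.2 hp.2
  differentiableOn x y v hy hv := by
    refine hG.1.comp (f := fun ζ : ℂ => bitube (x + ζ.re • v) (y + ζ.im • v))
      (Differentiable.differentiableOn ?_) fun ζ hζ => bitube_mem_biHalfPlane.2 ?_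
    · have : (fun ζ : ℂ => bitube (x + ζ.re • v) (y + ζ.im • v)) = fun ζ : ℂ =>
          bitube x y + ζ • bitube v 0 := by
        funext ζ
        have hζ : (ζ : ℂ) = ζ.re + ζ.im * I := (re_add_im ζ).symm
        simp only [bitube]
        ext <;> simp <;> conv_rhs => rw [hζ]
        all_goals ring
      rw [this]
      fun_prop
    · have := convex_quadrant.add_smul_sub_mem hy hv hζ.2
      simpa using this
  lintegral_le y v hy hv := by
    set a : ℝ := min (min y.1 (y + v).1) (min y.2 (y + v).2) with ha
    set b : ℝ := max (max y.1 (y + v).1) (max y.2 (y + v).2) with hb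
    have ha0 : 0 < a := lt_min (lt_min hy.1 hv.1) (lt_min hy.2 hv.2)
    have hconv : ∀ t ∈ Icc (0 : ℝ) 1, y + t • v ∈ Icc a b ×ˢ Icc a b := by
      intro t ht
      have h1 : y ∈ Icc a b ×ˢ Icc a b := by
        refine ⟨⟨?_, ?_⟩, ?_, ?_⟩ <;> simp [ha, hb]
      have h2 : y + v ∈ Icc a b ×ˢ Icc a b := by
        refine ⟨⟨?_, ?_⟩, ?_, ?_⟩ <;> simp [ha, hb]
      have := ((convex_Icc a b).prod (convex_Icc a b)).add_smul_sub_mem h1 h2 ht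
      simpa using this
    obtain ⟨m, hm, hmle⟩ : ∃ m > 0, ∀ s ∈ Icc (a / 2) (b + a / 2), m ≤ s ^ α := by
      have hcont : ContinuousOn (fun s : ℝ => s ^ α) (Icc (a / 2) (b + a / 2)) := fun s hs =>
        (Real.continuousAt_rpow_const s α (Or.inl (by linarith [hs.1]))).continuousWithinAt
      obtain ⟨s₀, hs₀, h⟩ := isCompact_Icc.exists_isMinOn (nonempty_Icc.2 (by
        have := hconv 0 (by simp)
        linarith [this.1.1.trans this.1.2])) hcont
      exact ⟨s₀ ^ α, Real.rpow_pos_of_pos (by linarith [hs₀.1]) _, fun s hs => h hs⟩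
    set A := ENNReal.ofReal (Real.pi * (a / 2) ^ 2) ^ 2 with hA
    have hA0 : A ≠ 0 := pow_ne_zero _ (by
      rw [Ne, ENNReal.ofReal_eq_zero, not_le]; positivity)
    have hAt : A ≠ ∞ := by finiteness
    refine ⟨A⁻¹ * (ENNReal.ofReal (2 * (a / 2)) ^ 2 *
      (ENNReal.ofReal (m * m)⁻¹ * bergmanNorm α G ^ 2)), ?_, fun t ht => ?_⟩
    · have := hG.2
      exact ENNReal.mul_lt_top (ENNReal.inv_lt_top.2 (pos_iff_ne_zero.2 hA0)) (by finiteness)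
    obtain ⟨⟨h1, h2⟩, h3, h4⟩ := hconv t ht
    have key := mul_lintegral_fibre_le hG.1 (y := y + t • v) (r := a / 2) (by positivity)
      (by linarith) (by linarith)
    set S := {w : ℂ × ℂ | |w.1.im - (y + t • v).1| < a / 2 ∧ |w.2.im - (y + t • v).2| < a / 2}
      with hS
    have hSm : MeasurableSet S := IsOpen.measurableSet
      ((isOpen_lt (by fun_prop) (by fun_prop)).and (isOpen_lt (by fun_prop) (by fun_prop)))
    have hle : ∫⁻ w in S, ‖G w‖ₑ ^ 2 ≤ ENNReal.ofReal (m * m)⁻¹ * bergmanNorm α G ^ 2 := by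
      rw [bergmanNorm_sq_eq_setLIntegral, ← lintegral_const_mul' _ _ (by finiteness)]
      refine (setLIntegral_mono' hSm fun w hw => ?_).trans (lintegral_mono_set fun w hw => ?_)
      · have k1 := hmle w.1.im ⟨by linarith [(abs_lt.1 hw.1).1], by linarith [(abs_lt.1 hw.1).2]⟩
        have k2 := hmle w.2.im ⟨by linarith [(abs_lt.1 hw.2).1], by linarith [(abs_lt.1 hw.2).2]⟩
        rw [mul_left_comm, ← ENNReal.ofReal_mul (by positivity)]
        refine le_mul_of_one_le_right zero_le ?_
        rw [← ENNReal.ofReal_one]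
        refine ENNReal.ofReal_le_ofReal ?_
        rw [← div_eq_inv_mul, one_le_div (by positivity)]
        exact mul_le_mul k1 k2 hm.le (hm.le.trans k1)
      · exact ⟨by linarith [(abs_lt.1 hw.1).1], by linarith [(abs_lt.1 hw.2).1]⟩
    calc ∫⁻ x, ‖G (bitube x (y + t • v))‖ₑ ^ 2
        = A⁻¹ * (A * ∫⁻ x, ‖G (bitube x (y + t • v))‖ₑ ^ 2) := by
          rw [← mul_assoc, ENNReal.inv_mul_cancel hA0 hAt, one_mul]
      _ ≤ _ := mul_le_mul' le_rfl (key.trans (mul_le_mul' le_rfl hle))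

end Bergman

/-! ### Paley–Wiener for weighted Bergman spaces. -/

section BergmanFourier

open Set Filter Topology

/-- The Laplace transform of `s ^ α` at `4πt`. -/
def powerLaplace (α t : ℝ) : ℝ≥0∞ :=
  ∫⁻ s in Ioi (0 : ℝ), ENNReal.ofReal (s ^ α * Real.exp (-4 * Real.pi * (s * t)))

@[fun_prop]
theorem measurable_powerLaplace (α : ℝ) : Measurable (powerLaplace α) := by
  unfold powerLaplace
  fun_prop

theorem powerLaplace_of_pos {α : ℝ} (hα : -1 < α) {t : ℝ} (ht : 0 < t) :
    powerLaplace α t = ENNReal.ofReal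
      (Real.Gamma (α + 1) * (4 * Real.pi) ^ (-(α + 1)) * t ^ (-(α + 1))) := by
  have h := Real.integral_rpow_mul_exp_neg_mul_Ioi (a := α + 1) (r := 4 * Real.pi * t)
    (by linarith) (by positivity)
  simp only [add_sub_cancel_right] at h
  have hG := Real.Gamma_pos_of_pos (s := α + 1) (by linarith)
  have e : ∀ s : ℝ, s ^ α * Real.exp (-4 * Real.pi * (s * t))
      = s ^ α * Real.exp (-(4 * Real.pi * t * s)) := fun s => by congr 2; ring
  simp only [powerLaplace, e]
  rw [← ofReal_integral_eq_lintegral_ofReal, h]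
  · congr 1
    rw [one_div, Real.inv_rpow (by positivity), Real.mul_rpow (by positivity) ht.le,
      Real.rpow_neg (by positivity), Real.rpow_neg ht.le, mul_inv]
    ring
  · exact .of_integral_ne_zero (by rw [h]; positivity)
  · filter_upwards [ae_restrict_mem measurableSet_Ioi] with s hs
    have : 0 < s := hs
    positivity

/-- The exponential is at least `1` and no power is integrable on the whole half-line. The infinite
weight is what forces the density of a Bergman function to live on the quadrant. -/
theorem powerLaplace_of_nonpos (α : ℝ) {t : ℝ} (ht : t ≤ 0) : powerLaplace α t = ∞ := by
  by_contra h
  refine not_integrableOn_Ioi_rpow α ⟨by fun_prop, ?_⟩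
  refine lt_of_le_of_lt ?_ (lt_top_iff_ne_top.2 h)
  refine setLIntegral_mono' measurableSet_Ioi fun s hs => ?_
  have hs' : 0 < s := hs
  rw [Real.enorm_of_nonneg (by positivity)]
  refine ENNReal.ofReal_le_ofReal (le_mul_of_one_le_right (by positivity) (Real.one_le_exp ?_))
  have := mul_nonneg hs'.le (neg_nonneg.2 ht)
  nlinarith [Real.pi_pos]

theorem powerLaplace_ne_zero {α : ℝ} (hα : -1 < α) (t : ℝ) : powerLaplace α t ≠ 0 := by
  rcases le_or_gt t 0 with h | h
  · simp [powerLaplace_of_nonpos α h]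
  · have hG := Real.Gamma_pos_of_pos (s := α + 1) (by linarith)
    rw [powerLaplace_of_pos hα h, Ne, ENNReal.ofReal_eq_zero, not_le]
    positivity

theorem lintegral_quadrant_eq (α : ℝ) {g : ℝ × ℝ → ℂ} (hg : Measurable g) :
    ∫⁻ y in quadrant, ENNReal.ofReal (y.1 ^ α * y.2 ^ α) *
      ∫⁻ ξ, ‖g ξ‖ₑ ^ 2 * ENNReal.ofReal (Real.exp (-4 * Real.pi * (y.1 * ξ.1 + y.2 * ξ.2)))
    = ∫⁻ ξ, ‖g ξ‖ₑ ^ 2 * (powerLaplace α ξ.1 * powerLaplace α ξ.2) := by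
  have h1 : ∀ y ∈ quadrant, ENNReal.ofReal (y.1 ^ α * y.2 ^ α) *
      ∫⁻ ξ, ‖g ξ‖ₑ ^ 2 * ENNReal.ofReal (Real.exp (-4 * Real.pi * (y.1 * ξ.1 + y.2 * ξ.2)))
      = ∫⁻ ξ, ‖g ξ‖ₑ ^ 2 * (ENNReal.ofReal (y.1 ^ α * Real.exp (-4 * Real.pi * (y.1 * ξ.1))) *
        ENNReal.ofReal (y.2 ^ α * Real.exp (-4 * Real.pi * (y.2 * ξ.2)))) := by
    rintro y ⟨hy1, hy2⟩
    have hy1' : 0 < y.1 := hy1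
    rw [← lintegral_const_mul' _ _ (by finiteness)]
    refine lintegral_congr fun ξ => ?_
    rw [mul_left_comm, ← ENNReal.ofReal_mul' (Real.exp_pos _).le, ← ENNReal.ofReal_mul
      (by positivity), mul_add, Real.exp_add]
    congr 2
    ring
  rw [setLIntegral_congr_fun measurableSet_quadrant h1, lintegral_lintegral_swap (by fun_prop)]
  refine lintegral_congr fun ξ => ?_
  rw [lintegral_const_mul _ (by fun_prop), quadrant, Measure.volume_eq_prod, ← Measure.prod_restrict,
    lintegral_prod_mul (f := fun s : ℝ => ENNReal.ofReal (s ^ α * Real.exp (-4 * Real.pi * (s * ξ.1))))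
      (g := fun s : ℝ => ENNReal.ofReal (s ^ α * Real.exp (-4 * Real.pi * (s * ξ.2))))
      (by fun_prop) (by fun_prop)]
  rfl

theorem isAddHaarMeasure_prod : (volume : Measure (ℝ × ℝ)).IsAddHaarMeasure :=
  Measure.prod.instIsAddHaarMeasure _ _

/-- Split the exponential in two halves: one times `g` is square integrable by hypothesis, the other
is square integrable over the quadrant because it decays there. -/
theorem integrable_exp_mul_of_quadrant {g : ℝ × ℝ → ℂ} (hg : Measurable g)
    (hs : ∀ᵐ ξ, g ξ ≠ 0 → ξ ∈ quadrant) {y : ℝ × ℝ} (hy : y ∈ quadrant)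
    (h : ∫⁻ ξ, ‖g ξ‖ₑ ^ 2 * ENNReal.ofReal (Real.exp (-2 * Real.pi * (y.1 * ξ.1 + y.2 * ξ.2))) < ∞) :
    Integrable (fun ξ : ℝ × ℝ =>
      (Real.exp (-2 * Real.pi * (y.1 * ξ.1 + y.2 * ξ.2)) : ℂ) * g ξ) := by
  obtain ⟨hy1, hy2⟩ := hy
  rw [mem_Ioi] at hy1 hy2
  set u : ℝ × ℝ → ℂ := fun ξ => (Real.exp (-Real.pi * (y.1 * ξ.1 + y.2 * ξ.2)) : ℂ) * g ξ with hu
  have hum : AEStronglyMeasurable u := by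
    have : Measurable u := by fun_prop
    exact this.aestronglyMeasurable
  have hsq : ∀ ξ : ℝ × ℝ, Real.exp (-2 * Real.pi * (y.1 * ξ.1 + y.2 * ξ.2))
      = Real.exp (-Real.pi * (y.1 * ξ.1 + y.2 * ξ.2)) ^ 2 := fun ξ => by
    rw [← Real.exp_nat_mul]; congr 1; push_cast; ring
  have hui := (memLp_two_iff_integrable_sq_norm hum).1 ((memLp_two_iff_lintegral hum).2 (by
    refine (le_of_eq (lintegral_congr fun ξ => ?_)).trans_lt h
    rw [enorm_mul, mul_pow, mul_comm, ← ofReal_norm (Real.exp _ : ℂ), norm_real,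
      Real.norm_of_nonneg (Real.exp_pos _).le, ← ENNReal.ofReal_pow (Real.exp_pos _).le, hsq]))
  have := isAddHaarMeasure_prod
  set c := min y.1 y.2 with hc
  have hc0 : 0 < c := lt_min hy1 hy2
  have hei := integrable_exp_neg_mul_norm (volume : Measure (ℝ × ℝ)) hc0
  refine (hei.add hui).mono' (by
    have : Measurable fun ξ : ℝ × ℝ =>
      (Real.exp (-2 * Real.pi * (y.1 * ξ.1 + y.2 * ξ.2)) : ℂ) * g ξ := by fun_prop
    exact this.aestronglyMeasurable) ?_
  filter_upwards [hs] with ξ hξ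
  by_cases h0 : g ξ = 0
  · simp [h0]
    positivity
  obtain ⟨h1, h2⟩ := hξ h0
  rw [mem_Ioi] at h1 h2
  have hn : c * ‖ξ‖ ≤ y.1 * ξ.1 + y.2 * ξ.2 := by
    have : ‖ξ‖ ≤ ξ.1 + ξ.2 := by
      rw [Prod.norm_def, Real.norm_of_nonneg h1.le, Real.norm_of_nonneg h2.le]
      exact max_le (by linarith) (by linarith)
    calc c * ‖ξ‖ ≤ c * (ξ.1 + ξ.2) := by gcongr
      _ = c * ξ.1 + c * ξ.2 := mul_add _ _ _
      _ ≤ _ := by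
        gcongr
        · exact min_le_left _ _
        · exact min_le_right _ _
  have he : Real.exp (-Real.pi * (y.1 * ξ.1 + y.2 * ξ.2)) ^ 2 ≤ Real.exp (-c * ‖ξ‖) := by
    rw [← hsq]
    refine Real.exp_le_exp.2 ?_
    nlinarith [Real.pi_gt_three, (mul_nonneg hc0.le (norm_nonneg ξ)).trans hn]
  rw [Pi.add_apply, hu, norm_mul, norm_mul, norm_real, norm_real,
    Real.norm_of_nonneg (Real.exp_pos _).le, Real.norm_of_nonneg (Real.exp_pos _).le, hsq]
  have hp := Real.exp_pos (-Real.pi * (y.1 * ξ.1 + y.2 * ξ.2))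
  nlinarith [sq_nonneg (Real.exp (-Real.pi * (y.1 * ξ.1 + y.2 * ξ.2)) -
    Real.exp (-Real.pi * (y.1 * ξ.1 + y.2 * ξ.2)) * ‖g ξ‖), norm_nonneg (g ξ)]

/-- The Paley--Wiener theorem for weighted Bergman spaces on the product of two half-planes. -/
theorem MemBergman.exists_fourier_repr {α : ℝ} (hα : -1 < α) {G : ℂ × ℂ → ℂ}
    (hG : MemBergman α G) :
    ∃ g : ℝ × ℝ → ℂ, Measurable g ∧ (∀ᵐ ξ, g ξ ≠ 0 → ξ ∈ quadrant) ∧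
      ∫⁻ ξ, ‖g ξ‖ₑ ^ 2 * (powerLaplace α ξ.1 * powerLaplace α ξ.2) = bergmanNorm α G ^ 2 ∧
      (∀ y ∈ quadrant, Integrable (fun ξ : ℝ × ℝ =>
        (Real.exp (-2 * Real.pi * (y.1 * ξ.1 + y.2 * ξ.2)) : ℂ) * g ξ)) ∧
      ∀ z ∈ biHalfPlane, G z = ∫ ξ, cexp (2 * Real.pi * I * (z.1 * ξ.1 + z.2 * ξ.2)) * g ξ := by
  have hsi := isSquareIntegrableOnTube_of_memBergman hG
  obtain ⟨g, hg, h⟩ := hsi.exists_fourier_repr_of_equiv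
    measurePreserving_euclideanTwo convex_quadrant ⟨((1, 1) : ℝ × ℝ), by simp [quadrant]⟩
  simp only [inner_euclideanTwo] at h
  have hN : ∫⁻ ξ, ‖g ξ‖ₑ ^ 2 * (powerLaplace α ξ.1 * powerLaplace α ξ.2)
      = bergmanNorm α G ^ 2 := by
    rw [bergmanNorm_sq hG.1.continuousOn, ← lintegral_quadrant_eq α hg]
    exact setLIntegral_congr_fun measurableSet_quadrant fun y hy => by
      simp only [(h y hy).1]
  have hfin : bergmanNorm α G ^ 2 < ∞ := by have := hG.2; finiteness
  have hs : ∀ᵐ ξ, g ξ ≠ 0 → ξ ∈ quadrant := by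
    filter_upwards [ae_lt_top (by fun_prop) (hN.trans_lt hfin).ne] with ξ hξ h0
    have hg0 : ‖g ξ‖ₑ ^ 2 ≠ 0 := by simpa using h0
    by_contra hq
    rw [quadrant, mem_prod, mem_Ioi, mem_Ioi, not_and_or, not_lt, not_lt] at hq
    refine hξ.ne ?_
    rcases hq with hq | hq
    · rw [powerLaplace_of_nonpos α hq, ENNReal.top_mul (powerLaplace_ne_zero hα _),
        ENNReal.mul_top hg0]
    · rw [powerLaplace_of_nonpos α hq, ENNReal.mul_top (powerLaplace_ne_zero hα _),
        ENNReal.mul_top hg0]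
  have hi : ∀ y ∈ quadrant, Integrable (fun ξ : ℝ × ℝ =>
        (Real.exp (-2 * Real.pi * (y.1 * ξ.1 + y.2 * ξ.2)) : ℂ) * g ξ) := by
    intro y hy
    refine integrable_exp_mul_of_quadrant hg hs hy ?_
    -- At `y / 2` the squared weight `e^{-4π⟨y/2, ξ⟩}` is `e^{-2π⟨y, ξ⟩}`, the one needed for
    -- integrability at `y`.
    have hy' : (y.1 / 2, y.2 / 2) ∈ quadrant := by
      have h1 : 0 < y.1 := hy.1
      have h2 : 0 < y.2 := hy.2
      exact ⟨half_pos h1, half_pos h2⟩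
    obtain ⟨C, hC, hle⟩ := hsi.lintegral_le _ 0 hy' (by simpa using hy')
    refine (le_of_eq (lintegral_congr fun ξ => ?_)).trans_lt
      ((h _ hy').1.trans_lt (lt_of_le_of_lt (by simpa using hle 0 (by simp)) hC))
    congr 3
    ring
  refine ⟨g, hg, hs, hN, hi, fun z hz => ?_⟩
  have hy : (z.1.im, z.2.im) ∈ quadrant := hz
  have hz' : z = bitube (z.1.re, z.2.re) (z.1.im, z.2.im) := by simp [bitube]
  have := (h _ hy).2 (hi _ hy) (z.1.re, z.2.re)
  rw [← hz'] at this
  rw [this]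
  congr 1
  funext ξ
  congr 3
  conv_rhs => rw [hz']
  simp only [bitube]
  push_cast
  ring

/-- Fourier--Laplace integrals over the quadrant satisfy the norm estimate of the Bergman space. -/
theorem bergmanNorm_sq_le {α : ℝ} {G : ℂ × ℂ → ℂ} (hG : ContinuousOn G biHalfPlane)
    {g : ℝ × ℝ → ℂ} (hg : Measurable g)
    (hi : ∀ y ∈ quadrant, Integrable (fun ξ : ℝ × ℝ =>
        (Real.exp (-2 * Real.pi * (y.1 * ξ.1 + y.2 * ξ.2)) : ℂ) * g ξ))
    (hGg : ∀ z ∈ biHalfPlane, G z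
      = ∫ ξ, cexp (2 * Real.pi * I * (z.1 * ξ.1 + z.2 * ξ.2)) * g ξ) :
    bergmanNorm α G ^ 2 ≤ ∫⁻ ξ, ‖g ξ‖ₑ ^ 2 * (powerLaplace α ξ.1 * powerLaplace α ξ.2) := by
  rw [bergmanNorm_sq hG, ← lintegral_quadrant_eq α hg]
  refine setLIntegral_mono' measurableSet_quadrant fun y hy => ?_
  refine mul_le_mul' le_rfl ?_
  have h := lintegral_fourierInv_sq_le_of_equiv measurePreserving_euclideanTwo (hi y hy)
  simp only [inner_euclideanTwo] at h
  refine (le_of_eq (lintegral_congr fun x => ?_)).trans (h.trans_eq (lintegral_congr fun ξ => ?_))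
  · rw [hGg _ (bitube_mem_biHalfPlane.2 hy)]
    congr 3
    funext ξ
    rw [ofReal_exp, ← mul_assoc, ← Complex.exp_add]
    congr 2
    simp only [bitube]
    push_cast
    linear_combination (2 * Real.pi * (y.1 * ξ.1 + y.2 * ξ.2 : ℂ)) * I_sq
  · rw [enorm_mul, mul_pow, mul_comm, ← ofReal_norm (Real.exp _ : ℂ), norm_real,
      Real.norm_of_nonneg (Real.exp_pos _).le, ← ENNReal.ofReal_pow (Real.exp_pos _).le,
      ← Real.exp_nat_mul]
    congr 3
    push_cast; ring

end BergmanFourier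

/-! ### Restriction to `z₃ = 0` and the matching of weights. -/

section Comparison

open Set Filter Topology

/-- Since `μ` need not be σ-finite, Fubini is avoided: the product with a Dirac mass is identified
as the image of `μ` under `z ↦ (z, 0)`, a measurable embedding. -/
theorem setLIntegral_tubeDomain_prod_dirac (μ : Measure (ℂ × ℂ)) (H : C3 → ℝ≥0∞) :
    ∫⁻ z in tubeDomain, H z ∂(μ.prod (Measure.dirac (0 : ℂ)))
      = ∫⁻ z in biHalfPlane, H (z, 0) ∂μ := by
  have h1 : μ.prod (Measure.dirac (0 : ℂ)) = μ.map (fun z => (z, (0 : ℂ))) := by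
    rw [Measure.prod, ← Measure.bind_dirac_eq_map μ (by fun_prop)]
    congr 1
    funext z
    exact Measure.map_dirac' (by fun_prop) 0
  have hemb : MeasurableEmbedding (fun z : ℂ × ℂ => (z, (0 : ℂ))) := measurableEmbedding_prod_mk_right 0
  have h2 : (fun z : ℂ × ℂ => (z, (0 : ℂ))) ⁻¹' tubeDomain = biHalfPlane := by
    ext z
    simp only [tubeDomain, imPart, sphericalCone, coneDet, biHalfPlane, mem_preimage, mem_ofPred_eq,
      zero_im]
    constructor
    · rintro ⟨h, h'⟩
      refine ⟨h', ?_⟩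
      by_contra! h0
      nlinarith [mul_nonneg h'.le (neg_nonneg.2 h0)]
    · rintro ⟨h, h'⟩
      exact ⟨by have := mul_pos h h'; linarith, h⟩
  rw [h1, hemb.restrict_map, hemb.lintegral_map, h2]

theorem mk_zero_mem_tubeDomain {z : ℂ × ℂ} (hz : z ∈ biHalfPlane) : (z, (0 : ℂ)) ∈ tubeDomain := by
  have := mul_pos hz.1 hz.2
  exact ⟨by simpa [coneDet, imPart] using this, hz.1⟩

theorem cdot3_mk_zero (z : ℂ × ℂ) (ξ : R3) :
    cdot3 (z, 0) ξ = z.1 * ξ.1.1 + z.2 * ξ.1.2 := by simp [cdot3]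

namespace IsLaplaceAdmissible

variable {a : R3 → ℂ}

/-- At `z₃ = 0` the phase does not involve the third frequency, so Fubini integrates it out of the
density. -/
theorem fourierLaplace_mk_zero (ha : IsLaplaceAdmissible a) {z : ℂ × ℂ} (hz : z ∈ biHalfPlane) :
    fourierLaplace a (z, 0) = ∫ ξ : ℝ × ℝ, cexp (2 * Real.pi * I * (z.1 * ξ.1 + z.2 * ξ.2)) *
      ∫ s : ℝ, a (ξ, s) := by
  have hi := ha.integrable_cexp_mul (mk_zero_mem_tubeDomain hz)
  rw [fourierLaplace, Measure.volume_eq_prod, integral_prod _ hi]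
  simp only [cdot3_mk_zero, integral_const_mul]

theorem integrable_exp_mul_integral (ha : IsLaplaceAdmissible a) {y : ℝ × ℝ} (hy : y ∈ quadrant) :
    Integrable (fun ξ : ℝ × ℝ => (Real.exp (-2 * Real.pi * (y.1 * ξ.1 + y.2 * ξ.2)) : ℂ) *
      ∫ s : ℝ, a (ξ, s)) := by
  have hi := ha.integrable_cexp_mul
    (mk_zero_mem_tubeDomain (bitube_mem_biHalfPlane.2 hy : bitube 0 y ∈ biHalfPlane))
  have h := Integrable.integral_prod_left (μ := (volume : Measure (ℝ × ℝ)))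
    (ν := (volume : Measure ℝ)) hi
  simp only [cdot3_mk_zero, integral_const_mul] at h
  refine h.congr (Eventually.of_forall fun ξ => ?_)
  simp only [ofReal_exp]
  congr 2
  simp only [bitube]
  push_cast
  simp only [Prod.fst_zero, Prod.snd_zero, ofReal_zero, zero_add]
  linear_combination (2 * Real.pi * (y.1 * ξ.1 + y.2 * ξ.2 : ℂ)) * I_sq

end IsLaplaceAdmissible

theorem sq_lintegral_mul_le {X : Type*} [MeasurableSpace X] (μ : Measure X) {u v : X → ℝ≥0∞}
    (hu : AEMeasurable u μ) (hv : AEMeasurable v μ) :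
    (∫⁻ x, u x * v x ∂μ) ^ 2 ≤ (∫⁻ x, u x ^ 2 ∂μ) * ∫⁻ x, v x ^ 2 ∂μ := by
  have h := ENNReal.lintegral_mul_le_Lp_mul_Lq μ Real.HolderConjugate.two_two hu hv
  simp only [Pi.mul_apply, ENNReal.rpow_ofNat] at h
  calc _ ≤ ((∫⁻ x, u x ^ 2 ∂μ) ^ (1 / 2 : ℝ) * (∫⁻ x, v x ^ 2 ∂μ) ^ (1 / 2 : ℝ)) ^ 2 := by gcongr
    _ = _ := by
      rw [mul_pow, ← ENNReal.rpow_natCast, ← ENNReal.rpow_natCast, ← ENNReal.rpow_mul,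
        ← ENNReal.rpow_mul]
      norm_num

/-- The constant in the product of the two power weights. -/
def weightConst (m : ℕ) : ℝ :=
  (Real.Gamma (2 * m + 1 / 2) * (4 * Real.pi) ^ (-(2 * (m : ℝ) + 1 / 2))) ^ 2

theorem weightConst_pos (m : ℕ) : 0 < weightConst m := by
  have := Real.Gamma_pos_of_pos (s := 2 * (m : ℝ) + 1 / 2) (by positivity)
  unfold weightConst
  positivity

/-- Here `α + 1 = 2m + 1/2`. The integer part of the exponent will balance the symbol of `□^m`,
squared, and the square root the length of the slices of the cone. -/
theorem powerLaplace_mul_powerLaplace (m : ℕ) {ξ : ℝ × ℝ} (hξ : ξ ∈ quadrant) :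
    powerLaplace (2 * (m : ℝ) - 1 / 2) ξ.1 * powerLaplace (2 * (m : ℝ) - 1 / 2) ξ.2
      = ENNReal.ofReal (weightConst m / ((ξ.1 * ξ.2) ^ (2 * m) * √(ξ.1 * ξ.2))) := by
  have h1 : 0 < ξ.1 := hξ.1
  have h2 : 0 < ξ.2 := hξ.2
  have hα : -1 < 2 * (m : ℝ) - 1 / 2 := by linarith [m.cast_nonneg (α := ℝ)]
  have e : 2 * (m : ℝ) - 1 / 2 + 1 = 2 * (m : ℝ) + 1 / 2 := by ring
  have hG := Real.Gamma_pos_of_pos (s := 2 * (m : ℝ) + 1 / 2) (by positivity)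
  rw [powerLaplace_of_pos hα h1, powerLaplace_of_pos hα h2, e, ← ENNReal.ofReal_mul (by positivity)]
  congr 1
  have hp : (ξ.1 * ξ.2) ^ (2 * m) * √(ξ.1 * ξ.2) = (ξ.1 * ξ.2) ^ (2 * (m : ℝ) + 1 / 2) := by
    rw [Real.rpow_add (by positivity), Real.sqrt_eq_rpow, ← Real.rpow_natCast]
    push_cast
    rfl
  rw [hp, div_eq_mul_inv (weightConst m), ← Real.rpow_neg (by positivity), Real.mul_rpow h1.le h2.le, weightConst]
  ring

theorem measurableSet_dualCone : MeasurableSet dualCone := by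
  unfold dualCone
  measurability

end Comparison

/-! ### The restriction and extension operators. -/

section Carleson

open Set Filter Topology

theorem boxSymbol_mk (ξ : ℝ × ℝ) (s : ℝ) :
    boxSymbol (ξ, s) = 4 * Real.pi ^ 2 * (4 * (ξ.1 * ξ.2) - s ^ 2) := by
  simp only [boxSymbol]
  ring

@[fun_prop]
theorem continuous_boxSymbol : Continuous boxSymbol := by
  unfold boxSymbol
  fun_prop

/-- The restriction estimate on the Fourier side. -/
theorem enorm_integral_boxSymbol_sq_mul_le (m : ℕ) {f : R3 → ℂ} (hf : Measurable f)
    (hs : ∀ ξ, f ξ ≠ 0 → ξ ∈ dualCone) (ξ : ℝ × ℝ) :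
    ‖∫ s : ℝ, (boxSymbol (ξ, s) : ℂ) ^ m * f (ξ, s)‖ₑ ^ 2 *
      (powerLaplace (2 * (m : ℝ) - 1 / 2) ξ.1 * powerLaplace (2 * (m : ℝ) - 1 / 2) ξ.2)
    ≤ ENNReal.ofReal ((16 * Real.pi ^ 2) ^ (2 * m) * 4 * weightConst m) *
      ∫⁻ s : ℝ, ‖f (ξ, s)‖ₑ ^ 2 := by
  by_cases hξ : ξ ∈ quadrant
  · have h1 : 0 < ξ.1 := hξ.1
    have h2 : 0 < ξ.2 := hξ.2
    set p := ξ.1 * ξ.2 with hp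
    have hp0 : 0 < p := mul_pos h1 h2
    -- The slice of the dual cone over `ξ`, of length `4√p`; on it the symbol lies between `0` and
    -- `16π² p`. These are the sources of the constants.
    set S := Icc (-(2 * √p)) (2 * √p) with hS
    have hpt : ∀ s : ℝ, ‖(boxSymbol (ξ, s) : ℂ) ^ m * f (ξ, s)‖ₑ
        ≤ ENNReal.ofReal ((16 * Real.pi ^ 2 * p) ^ m) * (S.indicator 1 s * ‖f (ξ, s)‖ₑ) := by
      intro s
      by_cases h0 : f (ξ, s) = 0
      · simp [h0]
      obtain ⟨-, -, h3⟩ := hs _ h0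
      replace h3 : s ^ 2 ≤ 4 * p := by rw [hp, ← mul_assoc]; exact h3
      have hsS : s ∈ S := by
        have : |s| ≤ 2 * √p := by
          refine abs_le_of_sq_le_sq ?_ (by positivity)
          rw [mul_pow, Real.sq_sqrt hp0.le]
          linarith
        exact abs_le.1 this
      rw [indicator_of_mem hsS, Pi.one_apply, one_mul, enorm_mul]
      gcongr
      rw [← ofReal_norm, norm_pow, norm_real, boxSymbol_mk, Real.norm_of_nonneg (by
        have := sub_nonneg.2 h3
        positivity)]
      refine ENNReal.ofReal_le_ofReal (pow_le_pow_left₀ (by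
        have := sub_nonneg.2 h3
        positivity) ?_ m)
      nlinarith [mul_nonneg (sq_nonneg Real.pi) (sq_nonneg s)]
    have hfm : Measurable (fun s : ℝ => f (ξ, s)) := by fun_prop
    have hle : ‖∫ s : ℝ, (boxSymbol (ξ, s) : ℂ) ^ m * f (ξ, s)‖ₑ ^ 2
        ≤ ENNReal.ofReal ((16 * Real.pi ^ 2 * p) ^ m) ^ 2 *
          (ENNReal.ofReal (4 * √p) * ∫⁻ s : ℝ, ‖f (ξ, s)‖ₑ ^ 2) := by
      calc _ ≤ (∫⁻ s : ℝ, ENNReal.ofReal ((16 * Real.pi ^ 2 * p) ^ m) *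
            (S.indicator 1 s * ‖f (ξ, s)‖ₑ)) ^ 2 := by
            gcongr
            exact (enorm_integral_le_lintegral_enorm _).trans (lintegral_mono hpt)
        _ = ENNReal.ofReal ((16 * Real.pi ^ 2 * p) ^ m) ^ 2 *
            (∫⁻ s : ℝ, S.indicator 1 s * ‖f (ξ, s)‖ₑ) ^ 2 := by
            rw [lintegral_const_mul' _ _ (by finiteness), mul_pow]
        _ ≤ _ := by
            gcongr
            refine (sq_lintegral_mul_le _ (measurable_one.indicator measurableSet_Icc).aemeasurable
              hfm.enorm.aemeasurable).trans (mul_le_mul' (le_of_eq ?_) le_rfl)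
            have : ∀ s, (S.indicator (1 : ℝ → ℝ≥0∞) s) ^ 2 = S.indicator 1 s := fun s => by
              by_cases h : s ∈ S <;> simp [h]
            rw [lintegral_congr this, lintegral_indicator_one measurableSet_Icc, Real.volume_Icc]
            congr 1
            ring
    rw [powerLaplace_mul_powerLaplace m hξ, ← hp]
    refine (mul_le_mul' hle le_rfl).trans (le_of_eq ?_)
    have e : ((16 * Real.pi ^ 2 * p) ^ m) ^ 2 * (4 * √p) * (weightConst m / (p ^ (2 * m) * √p))
        = (16 * Real.pi ^ 2) ^ (2 * m) * 4 * weightConst m := by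
      have hs0 : 0 < √p := Real.sqrt_pos.2 hp0
      rw [← pow_mul, mul_comm m 2, mul_pow (16 * Real.pi ^ 2) p]
      field_simp
    have e' := congrArg ENNReal.ofReal e
    rw [ENNReal.ofReal_mul (by positivity), ENNReal.ofReal_mul (by positivity),
      ENNReal.ofReal_pow (by positivity)] at e'
    rw [← e']
    ring
  -- Off the quadrant the weight is infinite, so the integral must vanish exactly. It does, since a
  -- slice of the dual cone there contains at most `s = 0`.
  · have h0 : ∫ s : ℝ, (boxSymbol (ξ, s) : ℂ) ^ m * f (ξ, s) = 0 := by
      refine integral_eq_zero_of_ae ?_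
      filter_upwards [(Set.finite_singleton (0 : ℝ)).measure_zero volume |> compl_mem_ae_iff.2]
        with s hs0
      have : f (ξ, s) = 0 := by
        by_contra h
        obtain ⟨k1, k2, k3⟩ := hs _ h
        replace k1 : 0 ≤ ξ.1 := k1
        replace k2 : 0 ≤ ξ.2 := k2
        replace k3 : s ^ 2 ≤ 4 * ξ.1 * ξ.2 := k3
        refine hs0 ?_
        have : ξ.1 * ξ.2 ≤ 0 := by
          by_contra! hpos
          exact hξ ⟨pos_of_mul_pos_left hpos k2, pos_of_mul_pos_right hpos k1⟩
        have h4 : s ^ 2 ≤ 0 := by nlinarith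
        simpa using h4
      simp [this]
    rw [h0]
    simp

/-- Cutting the density off outside the cone changes it on a null set only, and makes the support
condition valid on every slice. -/
theorem MemHardy.exists_fourierLaplace_of_forall {F : C3 → ℂ} (hF : MemHardy F) :
    ∃ f : R3 → ℂ, Measurable f ∧ (∀ ξ, f ξ ≠ 0 → ξ ∈ dualCone) ∧
      ∫⁻ ξ, ‖f ξ‖ₑ ^ 2 ≤ hardyNorm F ^ 2 ∧ EqOn F (fourierLaplace f) tubeDomain := by
  obtain ⟨f, hf, hs, hle, heq⟩ := hF.exists_fourierLaplace
  have hae : dualCone.indicator f =ᵐ[volume] f := by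
    filter_upwards [hs] with ξ hξ
    by_cases h : ξ ∈ dualCone
    · simp [h]
    · rw [indicator_of_notMem h]
      by_contra h0
      exact h (hξ (Ne.symm h0))
  refine ⟨dualCone.indicator f, hf.indicator measurableSet_dualCone,
    fun ξ h => mem_of_indicator_ne_zero h, ?_, fun z hz => ?_⟩
  · refine (le_of_eq (lintegral_congr_ae ?_)).trans hle
    filter_upwards [hae] with ξ hξ
    rw [hξ]
  · rw [heq hz]
    refine integral_congr_ae ?_
    filter_upwards [hae] with ξ hξ
    rw [hξ]

/-- The restriction operator from the Hardy space to the Bergman space. -/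
theorem MemHardy.exists_memBergman (m : ℕ) {F : C3 → ℂ} (hF : MemHardy F) :
    ∃ G : ℂ × ℂ → ℂ, MemBergman (2 * (m : ℝ) - 1 / 2) G ∧
      bergmanNorm (2 * (m : ℝ) - 1 / 2) G ^ 2 ≤
        ENNReal.ofReal ((16 * Real.pi ^ 2) ^ (2 * m) * 4 * weightConst m) * hardyNorm F ^ 2 ∧
      ∀ z ∈ biHalfPlane, (box^[m] F) (z, 0) = G z := by
  have hC : hardyNorm F ^ 2 < ∞ := by have := hF.2; finiteness
  obtain ⟨f, hf, hs, hle, heq⟩ := hF.exists_fourierLaplace_of_forall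
  have hadm := isLaplaceAdmissible_of_lintegral_lt_top hf.aestronglyMeasurable (hle.trans_lt hC)
    (Eventually.of_forall hs)
  obtain ⟨hbox, ha⟩ := hadm.eqOn_box_iterate heq m
  set a : R3 → ℂ := fun ξ => (boxSymbol ξ : ℂ) ^ m * f ξ with hadef
  have ham : Measurable a := by fun_prop
  have hdiff : DifferentiableOn ℂ (fun z : ℂ × ℂ => fourierLaplace a (z, 0)) biHalfPlane :=
    ha.differentiableOn.comp (by fun_prop) fun z hz => mk_zero_mem_tubeDomain hz
  have hnorm : bergmanNorm (2 * (m : ℝ) - 1 / 2) (fun z => fourierLaplace a (z, 0)) ^ 2 ≤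
      ENNReal.ofReal ((16 * Real.pi ^ 2) ^ (2 * m) * 4 * weightConst m) * hardyNorm F ^ 2 := by
    refine (bergmanNorm_sq_le hdiff.continuousOn (g := fun ξ => ∫ s : ℝ, a (ξ, s))
      (ham.stronglyMeasurable.integral_prod_right').measurable
      (fun y hy => ha.integrable_exp_mul_integral hy)
      fun z hz => ha.fourierLaplace_mk_zero hz).trans ?_
    calc _ ≤ ∫⁻ ξ : ℝ × ℝ, ENNReal.ofReal ((16 * Real.pi ^ 2) ^ (2 * m) * 4 * weightConst m) *
          ∫⁻ s : ℝ, ‖f (ξ, s)‖ₑ ^ 2 :=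
          lintegral_mono fun ξ => enorm_integral_boxSymbol_sq_mul_le m hf hs ξ
      _ = ENNReal.ofReal ((16 * Real.pi ^ 2) ^ (2 * m) * 4 * weightConst m) *
          ∫⁻ ξ, ‖f ξ‖ₑ ^ 2 := by
          rw [lintegral_const_mul' _ _ (by finiteness), Measure.volume_eq_prod (ℝ × ℝ) ℝ,
            lintegral_prod _ (by fun_prop)]
      _ ≤ _ := by gcongr
  refine ⟨fun z => fourierLaplace a (z, 0), ⟨hdiff, ?_⟩, hnorm,
    fun z hz => hbox (mk_zero_mem_tubeDomain hz)⟩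
  have := hnorm.trans_lt (ENNReal.mul_lt_top ENNReal.ofReal_lt_top hC)
  rwa [ENNReal.pow_lt_top_iff, or_iff_left two_ne_zero] at this

open Classical in
/-- The density on the dual cone whose box restriction is the given density on the quadrant. -/
def boxLift (m : ℕ) (g : ℝ × ℝ → ℂ) (ξ : R3) : ℂ :=
  -- Only the inner half `|s| ≤ √p` of the slice is used: the symbol vanishes at the ends `±2√p`,
  -- but is at least `12π² p` here, so dividing by its power is harmless.
  if ξ.1 ∈ quadrant ∧ ξ.2 ^ 2 ≤ ξ.1.1 * ξ.1.2 then
    (((boxSymbol ξ) ^ m * (2 * √(ξ.1.1 * ξ.1.2)) : ℝ) : ℂ)⁻¹ * g ξ.1 else 0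

theorem measurable_boxLift (m : ℕ) {g : ℝ × ℝ → ℂ} (hg : Measurable g) :
    Measurable (boxLift m g) := by
  unfold boxLift
  refine Measurable.ite ?_ (by fun_prop) measurable_const
  have h1 : MeasurableSet {ξ : R3 | ξ.1 ∈ quadrant} := measurable_fst measurableSet_quadrant
  have h2 : MeasurableSet {ξ : R3 | ξ.2 ^ 2 ≤ ξ.1.1 * ξ.1.2} :=
    measurableSet_le (by fun_prop) (by fun_prop)
  exact h1.inter h2

theorem mem_dualCone_of_boxLift_ne_zero {m : ℕ} {g : ℝ × ℝ → ℂ} {ξ : R3}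
    (h : boxLift m g ξ ≠ 0) : ξ ∈ dualCone := by
  have h' : ξ.1 ∈ quadrant ∧ ξ.2 ^ 2 ≤ ξ.1.1 * ξ.1.2 := by
    by_contra hn
    exact h (if_neg hn)
  have h1 : 0 < ξ.1.1 := h'.1.1
  have h2 : 0 < ξ.1.2 := h'.1.2
  exact ⟨h1.le, h2.le, by nlinarith [mul_pos h1 h2, h'.2]⟩

theorem boxLift_of_mem {m : ℕ} {g : ℝ × ℝ → ℂ} {ξ : ℝ × ℝ} (hξ : ξ ∈ quadrant) (s : ℝ) :
    boxLift m g (ξ, s) = (Icc (-√(ξ.1 * ξ.2)) √(ξ.1 * ξ.2)).indicator (fun s =>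
      (((boxSymbol (ξ, s)) ^ m * (2 * √(ξ.1 * ξ.2)) : ℝ) : ℂ)⁻¹ * g ξ) s := by
  have h1 : 0 < ξ.1 := hξ.1
  have h2 : 0 < ξ.2 := hξ.2
  have hiff : s ^ 2 ≤ ξ.1 * ξ.2 ↔ s ∈ Icc (-√(ξ.1 * ξ.2)) √(ξ.1 * ξ.2) := by
    rw [mem_Icc, ← abs_le, ← Real.sqrt_le_sqrt_iff (by positivity), Real.sqrt_sq_eq_abs]
  by_cases hs : s ∈ Icc (-√(ξ.1 * ξ.2)) √(ξ.1 * ξ.2)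
  · rw [indicator_of_mem hs, boxLift, if_pos ⟨hξ, hiff.2 hs⟩]
  · rw [indicator_of_notMem hs, boxLift, if_neg fun h => hs (hiff.1 h.2)]

theorem le_boxSymbol {ξ : ℝ × ℝ} (hξ : ξ ∈ quadrant) {s : ℝ}
    (hs : s ∈ Icc (-√(ξ.1 * ξ.2)) √(ξ.1 * ξ.2)) :
    12 * Real.pi ^ 2 * (ξ.1 * ξ.2) ≤ boxSymbol (ξ, s) := by
  have h1 : 0 < ξ.1 := hξ.1
  have h2 : 0 < ξ.2 := hξ.2
  have h3 : s ^ 2 ≤ ξ.1 * ξ.2 := by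
    rw [← Real.sq_sqrt (mul_pos h1 h2).le]
    exact sq_le_sq' hs.1 hs.2
  rw [boxSymbol_mk]
  nlinarith [mul_nonneg (sq_nonneg Real.pi) (sub_nonneg.2 h3)]

/-- The symbol cancels and leaves the constant `g ξ / (2√p)` on an interval of length `2√p`. -/
theorem integral_boxSymbol_mul_boxLift (m : ℕ) {g : ℝ × ℝ → ℂ} {ξ : ℝ × ℝ}
    (hξ : g ξ ≠ 0 → ξ ∈ quadrant) :
    ∫ s : ℝ, (boxSymbol (ξ, s) : ℂ) ^ m * boxLift m g (ξ, s) = g ξ := by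
  by_cases h0 : g ξ = 0
  · simp [boxLift, h0]
  have hq := hξ h0
  have h1 : 0 < ξ.1 := hq.1
  have h2 : 0 < ξ.2 := hq.2
  have hp : 0 < √(ξ.1 * ξ.2) := Real.sqrt_pos.2 (mul_pos h1 h2)
  have e : ∀ s : ℝ, (boxSymbol (ξ, s) : ℂ) ^ m * boxLift m g (ξ, s)
      = (Icc (-√(ξ.1 * ξ.2)) √(ξ.1 * ξ.2)).indicator
        (fun _ => ((2 * √(ξ.1 * ξ.2) : ℝ) : ℂ)⁻¹ * g ξ) s := by
    intro s
    rw [boxLift_of_mem hq]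
    by_cases hs : s ∈ Icc (-√(ξ.1 * ξ.2)) √(ξ.1 * ξ.2)
    · have hb : boxSymbol (ξ, s) ≠ 0 :=
        ((by positivity : 0 < 12 * Real.pi ^ 2 * (ξ.1 * ξ.2)).trans_le (le_boxSymbol hq hs)).ne'
      rw [indicator_of_mem hs, indicator_of_mem hs]
      have hb' : (boxSymbol (ξ, s) : ℂ) ≠ 0 := by exact_mod_cast hb
      push_cast
      rw [mul_inv, mul_assoc, ← mul_assoc, mul_inv_cancel₀ (pow_ne_zero _ hb'), one_mul]
    · rw [indicator_of_notMem hs, indicator_of_notMem hs, mul_zero]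
  simp only [e]
  rw [integral_indicator measurableSet_Icc, setIntegral_const, measureReal_def, Real.volume_Icc,
    ENNReal.toReal_ofReal (by linarith), real_smul, ← mul_assoc,
    show √(ξ.1 * ξ.2) - -√(ξ.1 * ξ.2) = 2 * √(ξ.1 * ξ.2) by ring, mul_inv_cancel₀, one_mul]
  exact_mod_cast (by positivity)

/-- The extension estimate on the Fourier side. -/
theorem lintegral_boxLift_sq_le (m : ℕ) {g : ℝ × ℝ → ℂ} {ξ : ℝ × ℝ} (hξ : g ξ ≠ 0 → ξ ∈ quadrant) :
    ∫⁻ s : ℝ, ‖boxLift m g (ξ, s)‖ₑ ^ 2 ≤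
      ENNReal.ofReal (((12 * Real.pi ^ 2) ^ (2 * m) * 2 * weightConst m)⁻¹) *
      (‖g ξ‖ₑ ^ 2 * (powerLaplace (2 * (m : ℝ) - 1 / 2) ξ.1 *
        powerLaplace (2 * (m : ℝ) - 1 / 2) ξ.2)) := by
  by_cases h0 : g ξ = 0
  · simp [boxLift, h0]
  have hq := hξ h0
  have h1 : 0 < ξ.1 := hq.1
  have h2 : 0 < ξ.2 := hq.2
  have hw := weightConst_pos m
  set p := ξ.1 * ξ.2 with hp
  have hp0 : 0 < p := mul_pos h1 h2
  have hpt : ∀ s : ℝ, ‖boxLift m g (ξ, s)‖ₑ ^ 2 ≤ ENNReal.ofReal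
      (((12 * Real.pi ^ 2 * p) ^ m * (2 * √p))⁻¹) ^ 2 * ‖g ξ‖ₑ ^ 2 *
        (Icc (-√p) √p).indicator 1 s := by
    intro s
    rw [boxLift_of_mem hq, ← hp]
    by_cases hs : s ∈ Icc (-√p) √p
    · have hb := le_boxSymbol hq hs
      rw [← hp] at hb
      have hb0 : 0 < 12 * Real.pi ^ 2 * p := by positivity
      have hb1 := hb0.trans_le hb
      rw [indicator_of_mem hs, indicator_of_mem hs, Pi.one_apply, mul_one, enorm_mul, mul_pow]
      gcongr
      rw [← ofReal_norm, norm_inv, norm_real, Real.norm_of_nonneg (by positivity)]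
      refine ENNReal.ofReal_le_ofReal ?_
      gcongr
    · rw [indicator_of_notMem hs]
      simp
  refine (lintegral_mono hpt).trans (le_of_eq ?_)
  rw [lintegral_const_mul' _ _ (by finiteness), lintegral_indicator_one measurableSet_Icc,
    Real.volume_Icc, powerLaplace_mul_powerLaplace m hq, ← hp, ← ENNReal.ofReal_pow (by positivity)]
  have hs0 : 0 < √p := Real.sqrt_pos.2 hp0
  have e : (((12 * Real.pi ^ 2 * p) ^ m * (2 * √p))⁻¹) ^ 2 * (√p - -√p)
      = ((12 * Real.pi ^ 2) ^ (2 * m) * 2 * weightConst m)⁻¹ *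
        (weightConst m / (p ^ (2 * m) * √p)) := by
    rw [inv_pow, mul_pow, ← pow_mul, mul_comm m 2, mul_pow (12 * Real.pi ^ 2) p]
    field_simp
    ring
  calc _ = ‖g ξ‖ₑ ^ 2 * ENNReal.ofReal
        ((((12 * Real.pi ^ 2 * p) ^ m * (2 * √p))⁻¹) ^ 2 * (√p - -√p)) := by
        rw [ENNReal.ofReal_mul (by positivity)]
        ring
    _ = _ := by
        rw [e, ENNReal.ofReal_mul (by positivity)]
        ring

/-- The extension operator from the Bergman space to the Hardy space. -/
theorem MemBergman.exists_memHardy (m : ℕ) {G : ℂ × ℂ → ℂ}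
    (hG : MemBergman (2 * (m : ℝ) - 1 / 2) G) :
    ∃ F : C3 → ℂ, MemHardy F ∧ hardyNorm F ^ 2 ≤
        ENNReal.ofReal (((12 * Real.pi ^ 2) ^ (2 * m) * 2 * weightConst m)⁻¹) *
          bergmanNorm (2 * (m : ℝ) - 1 / 2) G ^ 2 ∧
      ∀ z ∈ biHalfPlane, (box^[m] F) (z, 0) = G z := by
  obtain ⟨g, hg, hs, hN, -, hGg⟩ := hG.exists_fourier_repr
    (by linarith [m.cast_nonneg (α := ℝ)] : -1 < 2 * (m : ℝ) - 1 / 2)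
  have hfin : bergmanNorm (2 * (m : ℝ) - 1 / 2) G ^ 2 < ∞ := by have := hG.2; finiteness
  have hm := measurable_boxLift m hg
  have hle : ∫⁻ ξ, ‖boxLift m g ξ‖ₑ ^ 2 ≤
      ENNReal.ofReal (((12 * Real.pi ^ 2) ^ (2 * m) * 2 * weightConst m)⁻¹) *
          bergmanNorm (2 * (m : ℝ) - 1 / 2) G ^ 2 := by
    rw [Measure.volume_eq_prod (ℝ × ℝ) ℝ, lintegral_prod _ (by fun_prop), ← hN,
      ← lintegral_const_mul' _ _ (by finiteness)]
    refine lintegral_mono_ae ?_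
    filter_upwards [hs] with ξ hξ using lintegral_boxLift_sq_le m hξ
  have hlt := hle.trans_lt (ENNReal.mul_lt_top ENNReal.ofReal_lt_top hfin)
  have hsupp : ∀ᵐ ξ, boxLift m g ξ ≠ 0 → ξ ∈ dualCone :=
    Eventually.of_forall fun ξ => mem_dualCone_of_boxLift_ne_zero
  obtain ⟨hF, hFle⟩ := memHardy_fourierLaplace hm.aestronglyMeasurable hlt hsupp
  refine ⟨fourierLaplace (boxLift m g), hF, hFle.trans hle, fun z hz => ?_⟩
  obtain ⟨hbox, ha⟩ := (isLaplaceAdmissible_of_lintegral_lt_top hm.aestronglyMeasurable hlt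
    hsupp).eqOn_box_iterate (fun _ _ => rfl) m
  rw [hbox (mk_zero_mem_tubeDomain hz), ha.fourierLaplace_mk_zero hz, hGg z hz]
  refine integral_congr_ae ?_
  filter_upwards [hs] with ξ hξ
  simp only [integral_boxSymbol_mul_boxLift m hξ]

end Carleson

end

/-- Each direction replaces the test function by its partner under extension or restriction: the
integrals against `μ` coincide and the norms are comparable, so the constant is only multiplied by
the operator bound. -/
theorem mainTheorem5 (μ : Measure (ℂ × ℂ)) (hμ : μ biHalfPlaneᶜ = 0) (m : ℕ) :
    IsBoxCarleson m (μ.prod (Measure.dirac (0 : ℂ))) ↔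
      IsBergmanCarleson (2 * (m : ℝ) - 1 / 2) μ := by
  have hw := weightConst_pos m
  simp only [IsBoxCarleson, IsBergmanCarleson, setLIntegral_tubeDomain_prod_dirac]
  constructor
  · rintro ⟨C, hC, h⟩
    refine ⟨C * ((12 * Real.pi ^ 2) ^ (2 * m) * 2 * weightConst m)⁻¹, by positivity,
      fun G hG => ?_⟩
    obtain ⟨F, hF, hle, hFG⟩ := hG.exists_memHardy
    calc _ = ∫⁻ z in biHalfPlane, ‖(box^[m] F) (z, 0)‖ₑ ^ 2 ∂μ :=
          setLIntegral_congr_fun measurableSet_biHalfPlane fun z hz => by simp only [hFG z hz]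
      _ ≤ ENNReal.ofReal C * hardyNorm F ^ 2 := h F hF
      _ ≤ _ := by
          rw [ENNReal.ofReal_mul hC.le, mul_assoc]
          gcongr
  · rintro ⟨C, hC, h⟩
    refine ⟨C * ((16 * Real.pi ^ 2) ^ (2 * m) * 4 * weightConst m), by positivity,
      fun F hF => ?_⟩
    obtain ⟨G, hG, hle, hFG⟩ := hF.exists_memBergman m
    calc _ = ∫⁻ z in biHalfPlane, ‖G z‖ₑ ^ 2 ∂μ :=
          setLIntegral_congr_fun measurableSet_biHalfPlane fun z hz => by simp only [hFG z hz]
      _ ≤ ENNReal.ofReal C * bergmanNorm (2 * (m : ℝ) - 1 / 2) G ^ 2 := h G hG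
      _ ≤ _ := by
          rw [ENNReal.ofReal_mul hC.le, mul_assoc]
          gcongr
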